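/- Let $n\ge 2$. For $\sigma\in\mathbb S_n$ write $c(\sigma)_i=\sigma(i)$, and let $\ell(\sigma)_i=\#\{j>i:\ c(\sigma)_j<c(\sigma)_i\}$ $(1\le i\le n)$ be its Lehmer code. The Lehmer register stores the digit $\ell(\sigma)_i\in\{0,\dots,n-i\}$ in binary in $\lceil\log_2(n-i+1)\rceil$ qubits. Let $\tau_s=(s\ \,s+1)$, and put $\pi_t=\tau_{t-1}\cdots\tau_2\tau_1$ and $\tilde\pi_t=\tau_t\tau_{t+1}\cdots\tau_{n-1}$ for $1\le t\le n$. A circuit implements the reordering unitary $U_\pi$ if it maps $|\ell(\sigma)\rangle\mapsto|\ell(\sigma\pi)\rangle$ for all $\sigma\in\mathbb S_n$; $U_s$ denotes $U_{\tau_s}$. Circuits consist of arbitrary one-qubit unitaries and CNOT gates and use no ancillary qubits; the depth is the number of layers of gates acting on disjoint qubits. There is an absolute constant $C>0$ such that for every $n\ge 2$ there are circuits $V_1,\dots,V_{n-1}$ on the Lehmer register such that $V_s$ acts only on the qubits of the digits $s$ and $s+1$, implements $U_s$, and has depth at most $Cn\log n$; and the following hold. 1. (Partial assignments.) Let $k\ge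 1$ and let $i_1,\dots,i_k\in\{1,\dots,n\}$ be distinct. There are $t_1,\dots,t_k$ such that $\pi=\pi_{t_1}\cdots\pi_{t_k}$ satisfies $\pi(k+1-l)=i_l$ for $l=1,\dots,k$ (so the indices are brought to the positions $k,k-1,\dots,1$), the resulting product expression of $\pi$ has at most $kn$ factors $\tau_s$, and the concatenation of the corresponding circuits $V_s$ implements $U_\pi$ and has depth at most $C\,k\,n^2\log n$. Moreover, for all $j_1,\dots,j_k\in\{1,\dots,n\}$, if $\varphi(\sigma)\in\{0,1\}$ indicates whether $c(\sigma)_{i_l}=j_l$ for all $l$, then there is a circuit of depth at most $C\,k^2\log^2 n$, acting only on the qubits of the first $k$ digits and one output qubit, that maps $|\ell(\sigma\pi)\rangle|b\rangle\mapsto|\ell(\sigma\pi)\rangle|b\oplus\varphi(\sigma)\rangle$ for all $\sigma\in\mathbb S_n$, $b\in\{0,1\}$. 2. (Partial rankings.) Let $k\ge 0$ and let $i_1,\dots,i_{k+1}\in\{1,\dots,n\}$ be distinct. There are $t_1,\dots,t_{k+1}$ such that $\pi=\tilde\pi_{t_1}\cdots\tilde\pi_{t_{k+1}}$ satisfies $\pi(n-k-1+l)=i_l$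 for $l=1,\dots,k+1$ (so the indices are brought to the positions $n-k,\dots,n$), the resulting product expression of $\pi$ has at most $(k+1)n$ factors $\tau_s$, and the concatenation of the corresponding circuits $V_s$ implements $U_\pi$. If $k\ge 1$, this concatenation has depth at most $C\,k\,n^2\log n$, and, if $\varphi(\sigma)\in\{0,1\}$ indicates whether $c(\sigma)_{i_1}>c(\sigma)_{i_2}>\dots>c(\sigma)_{i_{k+1}}$, there is a circuit of depth at most $C\,k^2\log^2 n$, acting only on the qubits of the last $k+1$ digits and one output qubit, that maps $|\ell(\sigma\pi)\rangle|b\rangle\mapsto|\ell(\sigma\pi)\rangle|b\oplus\varphi(\sigma)\rangle$ for all $\sigma\in\mathbb S_n$, $b\in\{0,1\}$. -/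

import Mathlib

noncomputable section

/-! Quantum circuits over the basic gates: all one-qubit unitaries and CNOT. -/

/-- A basic gate on qubits labelled by `W`: an arbitrary one-qubit unitary applied to qubit `q`, or
a controlled NOT with control `c` and target `t`. -/
inductive Gate (W : Type) : Type
  | single (q : W) (U : Matrix.unitaryGroup Bool ℂ) : Gate W
  | cnot (c t : W) (hct : c ≠ t) : Gate W

/-- The qubits on which a gate acts. -/
def Gate.wires {W : Type} : Gate W → Set W
  | .single q _ => {q}
  | .cnot c t _ => {c, t}

/-- The matrix of a gate in the computational basis (bit strings `W → Bool`): rows are indexed by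
output strings `x`, columns by input strings `y`. -/
def Gate.mat {W : Type} [Fintype W] [DecidableEq W] :
    Gate W → Matrix (W → Bool) (W → Bool) ℂ
  | .single q U => Matrix.of fun x y =>
      if ∀ w, w ≠ q → x w = y w then (U : Matrix Bool Bool ℂ) (x q) (y q) else 0
  | .cnot c t _ => Matrix.of fun x y =>
      if x = Function.update y t (xor (y t) (y c)) then 1 else 0

/-- A layer (one time step): gates acting on pairwise disjoint sets of qubits. -/
structure Layer (W : Type) where
  gates : List (Gate W)
  disjoint : gates.Pairwise fun g h => Disjoint g.wires h.wires

/-- The matrix of a layer; the factors commute. -/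
def Layer.mat {W : Type} [Fintype W] [DecidableEq W] (L : Layer W) :
    Matrix (W → Bool) (W → Bool) ℂ :=
  (L.gates.map Gate.mat).prod

/-- A circuit is a sequence of layers, the head of the list being applied first. Its only qubits
are those in `W`: there are no ancillas besides. -/
abbrev Circuit (W : Type) : Type := List (Layer W)

/-- The depth of a circuit is its number of layers. -/
def Circuit.depth {W : Type} (c : Circuit W) : ℕ := c.length

/-- The matrix of a circuit (the first layer is the rightmost factor). -/
def Circuit.mat {W : Type} [Fintype W] [DecidableEq W] (c : Circuit W) :
    Matrix (W → Bool) (W → Bool) ℂ :=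
  (c.reverse.map Layer.mat).prod

/-- All gates of the circuit act inside the set `S` of qubits. -/
def Circuit.ActsOn {W : Type} (c : Circuit W) (S : Set W) : Prop :=
  ∀ L ∈ c, ∀ g ∈ L.gates, g.wires ⊆ S

/-- The computational basis vector `|x⟩`. -/
def ket {W : Type} [DecidableEq W] [Fintype W] (x : W → Bool) : (W → Bool) → ℂ :=
  Pi.single x 1

/-! The Lehmer encoding. Positions and objects are numbered from `0`, so that the `i`-th digit of
the Lehmer code lies in `{0, …, n - 1 - i}`; the Cauchy encoding of `σ` is `i ↦ σ i`. -/

/-- The `i`-th digit of the Lehmer code of `σ`. -/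
def lehmer {n : ℕ} (σ : Equiv.Perm (Fin n)) (i : Fin n) : ℕ :=
  (Finset.univ.filter fun j : Fin n => i < j ∧ σ j < σ i).card

/-- The qubits of the Lehmer register: the `i`-th digit, which has `n - i` possible values, is
stored in `⌈log₂ (n - i)⌉` qubits. -/
abbrev LehmerWire (n : ℕ) : Type := Σ i : Fin n, Fin (Nat.clog 2 (n - (i : ℕ)))

/-- The bit string `ℓ(σ)`: the binary expansions of the digits of the Lehmer code. -/
def lehmerBits {n : ℕ} (σ : Equiv.Perm (Fin n)) : LehmerWire n → Bool :=
  fun w => (lehmer σ w.1).testBit (w.2 : ℕ)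

/-- The circuit implements the reordering unitary `U_π`, that is
`|ℓ(σ)⟩ ↦ |ℓ(σπ)⟩` for all permutations `σ`. -/
def ImplementsReorder {n : ℕ} (c : Circuit (LehmerWire n)) (π : Equiv.Perm (Fin n)) : Prop :=
  ∀ σ : Equiv.Perm (Fin n),
    (Circuit.mat c).mulVec (ket (lehmerBits σ)) = ket (lehmerBits (σ * π))

/-! Adjacent transpositions and the cycles moving one entry to the beginning or to the end. -/

/-- The adjacent transposition of the positions `s` and `s + 1`. -/
def adjSwap {n : ℕ} (s : Fin (n - 1)) : Equiv.Perm (Fin n) :=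
  Equiv.swap ⟨s, by omega⟩ ⟨s + 1, by omega⟩

/-- The word `s₁, s₂, …` of adjacent transpositions stands for `τ_{s₁} τ_{s₂} ⋯`. -/
def wordPerm {n : ℕ} (w : List (Fin (n - 1))) : Equiv.Perm (Fin n) :=
  (w.map adjSwap).prod

/-- The word `τ_{t-1} ⋯ τ_1 τ_0` of the cycle that brings the entry in position `t` to the
beginning and shifts the entries before it by one place. -/
def frontWord {n : ℕ} (t : Fin n) : List (Fin (n - 1)) :=
  (List.ofFn fun s : Fin (t : ℕ) => (⟨s, by omega⟩ : Fin (n - 1))).reverse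

/-- The word `τ_t τ_{t+1} ⋯ τ_{n-2}` of the cycle that brings the entry in position `t` to the
end and shifts the entries after it by one place. -/
def backWord {n : ℕ} (t : Fin n) : List (Fin (n - 1)) :=
  List.ofFn fun s : Fin (n - 1 - (t : ℕ)) => (⟨t + s, by omega⟩ : Fin (n - 1))

/-- The concatenation of the circuits `V s`, `s` running through the word `w` in order. -/
def wordCircuit {n : ℕ} (V : Fin (n - 1) → Circuit (LehmerWire n)) (w : List (Fin (n - 1))) :
    Circuit (LehmerWire n) :=
  (w.map V).flatten

/-! Constraints and the computation of their consistency predicate. -/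

/-- Consistency with the order-`k` partial assignment `c(σ)_{i_l} = j_l` for all `l`. -/
def PartialAssignment {n k : ℕ} (i : Fin k ↪ Fin n) (j : Fin k → Fin n)
    (σ : Equiv.Perm (Fin n)) : Prop :=
  ∀ l : Fin k, σ (i l) = j l

/-- Consistency with the order-`k` partial ranking
`c(σ)_{i_1} > c(σ)_{i_2} > ⋯ > c(σ)_{i_{k+1}}`. -/
def PartialRanking {n k : ℕ} (i : Fin (k + 1) ↪ Fin n) (σ : Equiv.Perm (Fin n)) : Prop :=
  ∀ l : Fin k, σ (i l.succ) < σ (i l.castSucc)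

/-- The basis string with `x` in the register and `b` in the additional output qubit `none`. -/
def withOutput {W : Type} (x : W → Bool) (b : Bool) : Option W → Bool :=
  fun o => o.elim b x

open Classical in
/-- On the register reordered by `π`, the circuit computes the predicate `φ` of `σ` into the output
qubit: `|ℓ(σπ)⟩|b⟩ ↦ |ℓ(σπ)⟩|b ⊕ φ(σ)⟩`. -/
def ComputesAfterReorder {n : ℕ} (c : Circuit (Option (LehmerWire n)))
    (π : Equiv.Perm (Fin n)) (φ : Equiv.Perm (Fin n) → Prop) : Prop :=
  ∀ (σ : Equiv.Perm (Fin n)) (b : Bool),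
    (Circuit.mat c).mulVec (ket (withOutput (lehmerBits (σ * π)) b)) =
      ket (withOutput (lehmerBits (σ * π)) (xor b (decide (φ σ))))

end

set_option linter.unusedSectionVars false

noncomputable section

variable {W : Type} [Fintype W] [DecidableEq W]

/-! Matrices realized by circuits of bounded depth. -/

/-! Multiplying `σ` on the right by the transposition of the positions `s` and `s + 1` changes only
the digits `a`, `b` stored there. Comparing these digits already decides which of the two entries is
larger, and the new pair is `(b, a - 1)` if `b < a` and `(b + 1, a)` if `a ≤ b`
(`lehmer_mul_adjSwap`). It remains to realize this map on O(log n) qubits without ancillas; the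
construction has depth O(log⁴ n), hence O(n log n).

Multiply controlled NOTs come first. A phase on `m` qubits splits into rotations with `m - 1, m - 2,
…` controls (`ctrlPhase_insert`). Each rotation is a commutator of two NOTs controlled by the two
halves of its controls, and each half lends its qubits as dirty ancillas for the other half, so the
rotation has linear depth (`Realizes.ctrlRot_linear`). The total depth is quadratic
(`Realizes.condNot_allOn`).

The digit map is then built by recursion on the number of bits (`exists_lehmerStep`). When the
leading bits agree, the same map is applied to the remaining bits; when they differ, the comparison
is settled and swaps, increments and decrements finish the job. No ancilla records the outcome of
the comparisons: `IsControl` carries a condition on qubits already treated, which can be recomputed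
in place around every gate. If the digit `s` has one qubit more than the digit `s + 1`,
`exists_lehmerStep_carry` treats the extra qubit.

Products of cycles bring the relevant indices to the beginning or to the end (`exists_front`,
`exists_back`). The first `k` values and the first `k` digits determine each other, and a decreasing
tail means that its digits are maximal. Either predicate therefore prescribes O(k log n) bits, or is
never satisfied, and a single multiply controlled NOT tests it in depth O(k² log² n). -/

theorem Circuit.mat_append (c d : Circuit W) :
    Circuit.mat (c ++ d) = Circuit.mat d * Circuit.mat c := by
  simp [Circuit.mat]

/-- The matrix `M` is realized on the qubits in `R` by a circuit of depth at most `d`. -/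
def Realizes (R : Set W) (d : ℕ) (M : Matrix (W → Bool) (W → Bool) ℂ) : Prop :=
  ∃ c : Circuit W, c.ActsOn R ∧ c.depth ≤ d ∧ c.mat = M

theorem Realizes.mono {R : Set W} {d e : ℕ} {M : Matrix (W → Bool) (W → Bool) ℂ}
    (h : Realizes R d M) (hde : d ≤ e) : Realizes R e M := by
  obtain ⟨c, h1, h2, h3⟩ := h
  exact ⟨c, h1, h2.trans hde, h3⟩

theorem Realizes.one (R : Set W) : Realizes R 0 1 :=
  ⟨[], by simp [Circuit.ActsOn], by simp [Circuit.depth], by simp [Circuit.mat]⟩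

theorem Realizes.mul {R : Set W} {d e : ℕ} {M N : Matrix (W → Bool) (W → Bool) ℂ}
    (hM : Realizes R d M) (hN : Realizes R e N) : Realizes R (d + e) (M * N) := by
  obtain ⟨c, h1, h2, h3⟩ := hM
  obtain ⟨c', h1', h2', h3'⟩ := hN
  refine ⟨c' ++ c, ?_, ?_, by rw [Circuit.mat_append, h3, h3']⟩
  · intro L hL
    rcases List.mem_append.1 hL with h | h
    exacts [h1' L h, h1 L h]
  · simp only [Circuit.depth, List.length_append] at *
    omega

theorem Realizes.gate {R : Set W} (g : Gate W) (hg : g.wires ⊆ R) : Realizes R 1 g.mat :=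
  ⟨[⟨[g], List.pairwise_singleton _ _⟩], by simpa [Circuit.ActsOn] using hg, le_rfl,
    by simp [Circuit.mat, Layer.mat]⟩

theorem matrix_ext_ket {M N : Matrix (W → Bool) (W → Bool) ℂ}
    (h : ∀ x, M.mulVec (ket x) = N.mulVec (ket x)) : M = N :=
  Matrix.ext_of_mulVec_single h

/-- The matrix mapping `|x⟩` to `|f x⟩`. -/
def permMat (f : (W → Bool) → (W → Bool)) : Matrix (W → Bool) (W → Bool) ℂ :=
  Matrix.of fun x y => if x = f y then 1 else 0

theorem permMat_ket (f : (W → Bool) → (W → Bool)) (x : W → Bool) :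
    (permMat f).mulVec (ket x) = ket (f x) := by
  ext y
  simp [permMat, ket, Matrix.col, Pi.single_apply]

theorem permMat_mul (f g : (W → Bool) → (W → Bool)) :
    permMat f * permMat g = permMat (f ∘ g) := by
  refine matrix_ext_ket fun x => ?_
  rw [← Matrix.mulVec_mulVec]
  simp [permMat_ket]

theorem diagonal_ket (d : (W → Bool) → ℂ) (x : W → Bool) :
    (Matrix.diagonal d).mulVec (ket x) = d x • ket x := by
  ext y
  by_cases h : y = x <;> simp [ket, Matrix.mulVec_diagonal, h]

/-- The matrix acting on qubit `t` by the one-qubit matrix `F x`. -/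
def block (t : W) (F : (W → Bool) → Matrix Bool Bool ℂ) : Matrix (W → Bool) (W → Bool) ℂ :=
  Matrix.of fun x y => if ∀ w, w ≠ t → x w = y w then F y (x t) (y t) else 0

theorem block_ket (t : W) (F : (W → Bool) → Matrix Bool Bool ℂ) (x : W → Bool) :
    (block t F).mulVec (ket x) = ∑ b, F x b (x t) • ket (Function.update x t b) := by
  ext y
  have key : ∀ b, y = Function.update x t b ↔ (∀ w, w ≠ t → y w = x w) ∧ y t = b := by
    intro b
    constructor
    · rintro rfl
      exact ⟨fun w hw => by simp [hw], by simp⟩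
    · rintro ⟨h1, h2⟩
      funext w
      by_cases hw : w = t
      · subst hw; simp [h2]
      · simp [hw, h1 w hw]
  simp only [ket, Matrix.mulVec_single_one, Matrix.col_apply, block, Matrix.of_apply,
    Finset.sum_apply, Pi.smul_apply, Pi.single_apply, key, smul_eq_mul]
  by_cases h : ∀ w, w ≠ t → y w = x w
  · cases y t <;> simp
  · simp [h]

theorem block_mul (t : W) (F G : (W → Bool) → Matrix Bool Bool ℂ)
    (hF : ∀ x b, F (Function.update x t b) = F x) :
    block t F * block t G = block t fun x => F x * G x := by
  refine matrix_ext_ket fun x => ?_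
  rw [← Matrix.mulVec_mulVec, block_ket, block_ket]
  simp only [Fintype.sum_bool, Matrix.mulVec_add, Matrix.mulVec_smul, block_ket, hF,
    Function.update_self, Function.update_idem, Matrix.mul_apply, smul_add, add_smul, smul_smul]
  simp only [mul_comm]
  abel

theorem Realizes.single {R : Set W} {t : W} (ht : t ∈ R) (U : Matrix Bool Bool ℂ)
    (hU : U ∈ Matrix.unitaryGroup Bool ℂ) : Realizes R 1 (block t fun _ => U) :=
  Realizes.gate (.single t ⟨U, hU⟩) (by simpa [Gate.wires] using ht)

/-- Negate qubit `t` under the condition `P`. -/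
def condNot (t : W) (P : (W → Bool) → Bool) (x : W → Bool) : W → Bool :=
  Function.update x t (xor (x t) (P x))

theorem condNot_self (t : W) (P : (W → Bool) → Bool) (x : W → Bool) :
    condNot t P x t = xor (x t) (P x) := by simp [condNot]

theorem condNot_of_ne {t w : W} (P : (W → Bool) → Bool) (x : W → Bool) (h : w ≠ t) :
    condNot t P x w = x w := by simp [condNot, h]

/-- The matrix of the NOT gate. -/
def notMat : Matrix Bool Bool ℂ := Matrix.of fun a b => if a = b then 0 else 1

theorem notMat_mem : notMat ∈ Matrix.unitaryGroup Bool ℂ := by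
  rw [Matrix.mem_unitaryGroup_iff]
  ext a b
  cases a <;> cases b <;> simp [notMat, Matrix.mul_apply, Matrix.star_apply]

theorem permMat_condNot (t : W) (P : (W → Bool) → Bool) :
    permMat (condNot t P) = block t fun x => if P x then notMat else 1 := by
  refine matrix_ext_ket fun x => ?_
  rw [permMat_ket, block_ket]
  cases hP : P x <;> cases hx : x t <;>
    simp [condNot, hP, hx, notMat, Matrix.one_apply]

theorem Realizes.cnot {R : Set W} {c t : W} (hct : c ≠ t) (hc : c ∈ R) (ht : t ∈ R) :
    Realizes R 1 (permMat (condNot t fun x => x c)) :=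
  Realizes.gate (.cnot c t hct) (by
    intro w hw
    rcases hw with rfl | rfl
    exacts [hc, ht])

theorem Realizes.not {R : Set W} {t : W} (ht : t ∈ R) :
    Realizes R 1 (permMat (condNot t fun _ => true)) := by
  rw [permMat_condNot]
  exact Realizes.single ht _ notMat_mem

/-- The one-qubit diagonal matrix with entries `u` (at `false`) and `v` (at `true`). -/
def diagMat (u v : ℂ) : Matrix Bool Bool ℂ := Matrix.diagonal fun b => if b then v else u

theorem diagMat_mem {u v : ℂ} (hu : ‖u‖ = 1) (hv : ‖v‖ = 1) :
    diagMat u v ∈ Matrix.unitaryGroup Bool ℂ := by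
  rw [Matrix.mem_unitaryGroup_iff, diagMat, Matrix.star_eq_conjTranspose,
    Matrix.diagonal_conjTranspose, Matrix.diagonal_mul_diagonal, ← Matrix.diagonal_one]
  congr 1
  funext b
  cases b <;> simp [Complex.mul_conj, Complex.normSq_eq_norm_sq, hu, hv]

theorem block_diagMat (t : W) (u v : (W → Bool) → ℂ) :
    (block t fun x => diagMat (u x) (v x)) =
      Matrix.diagonal fun x => if x t then v x else u x := by
  refine matrix_ext_ket fun x => ?_
  rw [block_ket, diagonal_ket]
  cases hx : x t <;> simp [diagMat] <;> rw [← hx, Function.update_eq_self]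

/-- All qubits in `S` are set. -/
def allOn (S : Finset W) (x : W → Bool) : Bool := decide (∀ w ∈ S, x w = true)

theorem allOn_empty (x : W → Bool) : allOn ∅ x = true := by simp [allOn]

theorem allOn_insert (c : W) (S : Finset W) (x : W → Bool) :
    allOn (insert c S) x = (x c && allOn S x) := by
  rw [Bool.eq_iff_iff]; simp [allOn]

theorem allOn_union (A B : Finset W) (x : W → Bool) :
    allOn (A ∪ B) x = (allOn A x && allOn B x) := by
  rw [Bool.eq_iff_iff]; simp [allOn, or_imp, forall_and]

theorem allOn_update {S : Finset W} {t : W} (ht : t ∉ S) (x : W → Bool) (b : Bool) :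
    allOn S (Function.update x t b) = allOn S x := by
  rw [Bool.eq_iff_iff]
  simp only [allOn, decide_eq_true_eq]
  refine forall₂_congr fun w hw => ?_
  rw [Function.update_of_ne (by rintro rfl; exact ht hw)]

/-! ### Multiply controlled rotations, phases and the Toffoli gate. -/

theorem exists_unit_pow_eq {z : ℂ} (hz : ‖z‖ = 1) {m : ℕ} (hm : 0 < m) :
    ∃ w : ℂ, ‖w‖ = 1 ∧ w ^ m = z := by
  obtain ⟨w, hw⟩ := IsAlgClosed.exists_pow_nat_eq z hm
  refine ⟨w, ?_, hw⟩
  rw [← hw, norm_pow] at hz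
  exact (pow_eq_one_iff_of_nonneg (norm_nonneg _) hm.ne').1 hz

/-- The rotation `diag(w⁻¹, w)` of qubit `t`, controlled by the qubits in `S`. -/
def ctrlRot (S : Finset W) (t : W) (w : ℂ) : Matrix (W → Bool) (W → Bool) ℂ :=
  Matrix.diagonal fun x => if allOn S x then (if x t then w else w⁻¹) else 1

/-- The phase `z` on the strings in which all qubits of `S` are set. -/
def ctrlPhase (S : Finset W) (z : ℂ) : Matrix (W → Bool) (W → Bool) ℂ :=
  Matrix.diagonal fun x => if allOn S x then z else 1

theorem Realizes.rot {R : Set W} {t : W} (ht : t ∈ R) {v : ℂ} (hv : ‖v‖ = 1) :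
    Realizes R 1 (Matrix.diagonal fun x : W → Bool => if x t then v else v⁻¹) := by
  have h := Realizes.single ht _ (diagMat_mem (u := v⁻¹) (v := v) (by simp [hv]) hv)
  rwa [block_diagMat] at h

/-- A NOT on `t` inverts the rotation `diag(v⁻¹, v)`. In the alternating product of the two
controlled NOTs with the rotations by `v` and `v⁻¹`, everything cancels unless both conditions hold;
then the four rotations add up to `v ^ 4`, which is why a fourth root of `w` is taken. -/
theorem Realizes.ctrlRot {R : Set W} {A B : Finset W} {t : W} {d e : ℕ} (ht : t ∈ R)
    (hA : t ∉ A) (hB : t ∉ B) (hdA : Realizes R d (permMat (condNot t (allOn A))))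
    (hdB : Realizes R e (permMat (condNot t (allOn B)))) {w : ℂ} (hw : ‖w‖ = 1) :
    Realizes R (2 * d + 2 * e + 4) (_root_.ctrlRot (A ∪ B) t w) := by
  obtain ⟨v, hv, rfl⟩ := exists_unit_pow_eq hw (m := 4) (by norm_num)
  have hv0 : v ≠ 0 := by rintro rfl; simp at hv
  have h1 := Realizes.rot ht hv
  have h2 := Realizes.rot ht (v := v⁻¹) (by simp [hv])
  refine (((((((hdA.mul h2).mul hdB).mul h1).mul hdA).mul h2).mul hdB).mul h1).mono
    (by omega) |> (Eq.subst (motive := Realizes R _) ?_)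
  refine matrix_ext_ket fun x => ?_
  simp only [← Matrix.mulVec_mulVec, diagonal_ket, permMat_ket, Matrix.mulVec_smul, smul_smul,
    _root_.ctrlRot, allOn_union]
  have hfl : ∀ (S : Finset W) (y : W → Bool) b, t ∉ S →
      allOn S (Function.update y t b) = allOn S y := fun S y b h => allOn_update h y b
  have hup : ∀ b, x t = b → Function.update x t b = x := by
    rintro b rfl
    exact Function.update_eq_self _ _
  simp only [condNot, hfl _ _ _ hA, hfl _ _ _ hB, Function.update_self, Function.update_idem]
  cases ha : allOn A x <;> cases hb : allOn B x <;> cases hx : x t <;>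
    simp [hv0, hup _ hx] <;> field_simp

/-- If `S` is on, the rotation and the smaller phase combine to `w * w` when `t` is on and to `w⁻¹ *
w = 1` when it is off. This removes one qubit from a phase at the price of a rotation. -/
theorem ctrlPhase_insert {S : Finset W} {t : W} {w : ℂ} (hw : w ≠ 0) :
    ctrlPhase (insert t S) (w ^ 2) = ctrlRot S t w * ctrlPhase S w := by
  rw [ctrlPhase, ctrlRot, ctrlPhase, Matrix.diagonal_mul_diagonal]
  congr 1
  funext x
  rw [allOn_insert]
  cases allOn S x <;> cases x t <;> simp [hw, sq]

theorem Realizes.ctrlPhase_singleton {R : Set W} {t : W} (ht : t ∈ R) {z : ℂ} (hz : ‖z‖ = 1) :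
    Realizes R 1 (ctrlPhase {t} z) := by
  have h := Realizes.single ht _ (diagMat_mem (u := 1) (v := z) (by simp) hz)
  rw [block_diagMat] at h
  simpa [ctrlPhase, allOn] using h

/-- The Hadamard gate. -/
def hadMat : Matrix Bool Bool ℂ :=
  (((Real.sqrt 2)⁻¹ : ℝ) : ℂ) • Matrix.of fun a b => if a && b then -1 else 1

theorem inv_sqrt_two_mul_self :
    (((Real.sqrt 2)⁻¹ : ℝ) : ℂ) * (((Real.sqrt 2)⁻¹ : ℝ) : ℂ) = 1 / 2 := by
  rw [← Complex.ofReal_mul, ← mul_inv, Real.mul_self_sqrt (by norm_num)]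
  norm_num

theorem hadMat_mul_self : hadMat * hadMat = 1 := by
  have h := inv_sqrt_two_mul_self
  ext a b
  cases a <;> cases b <;>
    simp only [hadMat, Matrix.smul_mul, Matrix.mul_smul, smul_smul, h] <;>
    norm_num [Matrix.mul_apply]

theorem hadMat_mem : hadMat ∈ Matrix.unitaryGroup Bool ℂ := by
  rw [Matrix.mem_unitaryGroup_iff]
  have : star hadMat = hadMat := by
    ext a b
    cases a <;> cases b <;> simp [hadMat, Matrix.star_apply]
  rw [this, hadMat_mul_self]

theorem hadMat_conj : hadMat * (diagMat 1 (-1) * hadMat) = notMat := by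
  have h := inv_sqrt_two_mul_self
  ext a b
  cases a <;> cases b <;>
    simp only [hadMat, Matrix.smul_mul, Matrix.mul_smul, smul_smul, h] <;>
    simp [Matrix.mul_apply, diagMat, notMat, Matrix.diagonal_apply] <;> norm_num

/-- A multiply controlled NOT is a multiply controlled phase conjugated by Hadamard gates. -/
theorem Realizes.condNot_allOn_of_ctrlPhase {R : Set W} {S : Finset W} {t : W} {d : ℕ} (ht : t ∈ R)
    (hS : t ∉ S) (h : Realizes R d (ctrlPhase (insert t S) (-1))) :
    Realizes R (d + 2) (permMat (condNot t (allOn S))) := by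
  have hH := Realizes.single ht _ hadMat_mem
  refine (hH.mul (h.mul hH)).mono (by omega) |> (Eq.subst (motive := Realizes R _) ?_)
  have e : ctrlPhase (insert t S) (-1) =
      block t fun x => diagMat 1 (if allOn S x then -1 else 1) := by
    rw [block_diagMat, ctrlPhase]
    congr 1
    funext x
    rw [allOn_insert]
    cases allOn S x <;> cases x t <;> simp
  rw [e, block_mul _ _ _ (fun x b => by rw [allOn_update hS]), block_mul _ _ _ (fun _ _ => rfl),
    permMat_condNot]
  congr 1
  funext x
  cases allOn S x
  · have : diagMat 1 1 = 1 := by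
      rw [diagMat, ← Matrix.diagonal_one]
      congr 1
      funext b
      cases b <;> rfl
    simp [this, hadMat_mul_self]
  · simp [hadMat_conj]

theorem allOn_singleton (c : W) (x : W → Bool) : allOn {c} x = x c := by
  simp [allOn]

theorem Realizes.toffoli {R : Set W} {a b t : W} (hab : a ≠ b) (hat : a ≠ t) (hbt : b ≠ t)
    (ha : a ∈ R) (hb : b ∈ R) (ht : t ∈ R) :
    Realizes R 19 (permMat (condNot t fun x => x a && x b)) := by
  have e1 : ∀ c : W, (allOn {c} : (W → Bool) → Bool) = fun x => x c :=
    fun c => funext (allOn_singleton c)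
  have e0 : (allOn ∅ : (W → Bool) → Bool) = fun _ => true := funext allOn_empty
  -- The phase -1 on three qubits is peeled down to one qubit, with a square root taken at each of
  -- the two peelings: -1 = w² and w = v². The depths are 8 + 8 + 1, plus 2 for the Hadamard gates.
  obtain ⟨w, hw, hw2⟩ := exists_unit_pow_eq (z := -1) (by simp) (m := 2) (by norm_num)
  obtain ⟨v, hv, rfl⟩ := exists_unit_pow_eq hw (m := 2) (by norm_num)
  have hv0 : v ≠ 0 := by rintro rfl; simp at hv
  have h1 : Realizes R 8 (_root_.ctrlRot ({a} ∪ {b}) t (v ^ 2)) :=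
    Realizes.ctrlRot (d := 1) (e := 1) ht (by simpa using hat.symm) (by simpa using hbt.symm)
      (by rw [e1]; exact Realizes.cnot hat ha ht) (by rw [e1]; exact Realizes.cnot hbt hb ht) hw
  have h2 : Realizes R 8 (_root_.ctrlRot ({b} ∪ ∅) a v) :=
    Realizes.ctrlRot (d := 1) (e := 1) ha (by simpa using hab) (by simp)
      (by rw [e1]; exact Realizes.cnot hab.symm hb ha) (by rw [e0]; exact Realizes.not ha) hv
  have h3 := Realizes.ctrlPhase_singleton hb hv
  have h4 : Realizes R 17 (ctrlPhase (insert t {a, b}) (-1)) := by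
    rw [← hw2, ctrlPhase_insert (pow_ne_zero 2 hv0),
      ctrlPhase_insert (t := a) (S := {b}) hv0]
    exact h1.mul (h2.mul h3)
  have h5 := Realizes.condNot_allOn_of_ctrlPhase ht
    (by simp [hat.symm, hbt.symm]) h4
  refine Eq.subst (motive := Realizes R _) ?_ h5
  congr 2
  funext x
  rw [allOn_insert, allOn_singleton]

theorem Realizes.comp {R : Set W} {d e : ℕ} {f g : (W → Bool) → (W → Bool)}
    (hf : Realizes R d (permMat f)) (hg : Realizes R e (permMat g)) :
    Realizes R (d + e) (permMat fun x => f (g x)) := by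
  have := hf.mul hg
  rwa [permMat_mul] at this

theorem Realizes.id (R : Set W) : Realizes R 0 (permMat fun x : W → Bool => x) := by
  refine Eq.subst (motive := Realizes R 0) ?_ (Realizes.one R)
  refine matrix_ext_ket fun x => ?_
  rw [permMat_ket, Matrix.one_mulVec]

/-! ### Multiply controlled NOTs: linear depth with dirty ancillas, quadratic depth without. -/

theorem condNot_condNot {t : W} {P : (W → Bool) → Bool}
    (hP : ∀ x b, P (Function.update x t b) = P x) (x : W → Bool) :
    condNot t P (condNot t P x) = x := by
  simp [condNot, hP]

theorem allOn_congr {S : Finset W} {x y : W → Bool} (h : ∀ w ∈ S, x w = y w) :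
    allOn S x = allOn S y := by
  rw [Bool.eq_iff_iff]
  simp only [allOn, decide_eq_true_eq]
  exact forall₂_congr fun w hw => by rw [h w hw]

/-- A ladder of Toffoli gates over dirty ancillas computes a conjunction into its last qubit, up
to modifying the ancillas; two ladders in succession restore them. -/
theorem exists_toffoli_ladder {R : Set W} {A : Finset W} (hA : A.Nonempty) :
    ∀ (t : W) (B : Finset W), t ∉ A → t ∉ B → Disjoint A B → B.card + 1 = A.card →
      (∀ w ∈ A, w ∈ R) → (∀ w ∈ B, w ∈ R) → t ∈ R →
      ∃ f : (W → Bool) → (W → Bool), Realizes R (38 * B.card + 1) (permMat f) ∧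
        (∀ x, f (f x) = x) ∧ (∀ x, f x t = xor (x t) (allOn A x)) ∧
        (∀ x w, w ≠ t → w ∉ B → f x w = x w) ∧
        (∀ x u b, u ≠ t → u ∉ A → u ∉ B →
          f (Function.update x u b) = Function.update (f x) u b) ∧
        Realizes R (76 * B.card + 2) (permMat (condNot t (allOn A))) := by
  induction hA using Finset.Nonempty.cons_induction with
  | singleton c =>
    intro t B htA htB _ hcard hAR _ htR
    have hB : B = ∅ := by
      rw [← Finset.card_eq_zero]
      simpa using hcard
    subst hB
    have hct : c ≠ t := by rintro rfl; simp at htA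
    have e : (allOn {c} : (W → Bool) → Bool) = fun x => x c := funext (allOn_singleton c)
    have hR := Realizes.cnot hct (hAR c (by simp)) htR
    refine ⟨condNot t (allOn {c}), by simpa [e] using hR, fun x => ?_, fun x => ?_,
      fun x w hw _ => condNot_of_ne _ _ hw, fun x u b hut huA _ => ?_,
      by rw [e]; exact hR.mono (by simp)⟩
    · exact condNot_condNot (fun x b => allOn_update htA x b) x
    · exact condNot_self _ _ _
    · rw [condNot, condNot, allOn_update huA, Function.update_of_ne hut.symm,
        Function.update_comm hut.symm]
  | cons c A hcA hne ih =>
    intro t B htA htB hAB hcard hAR hBR htR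
    rw [Finset.cons_eq_insert] at *
    rw [Finset.card_insert_of_notMem hcA] at hcard
    have hcard' : B.card = A.card := by omega
    obtain ⟨a, ha⟩ : B.Nonempty := by
      rw [← Finset.card_pos, hcard']
      exact hne.card_pos
    simp only [Finset.mem_insert, not_or, forall_eq_or_imp, Finset.disjoint_insert_left] at *
    have haA : a ∉ A := fun h => Finset.disjoint_left.1 hAB.2 h ha
    have hta : t ≠ a := by rintro rfl; exact htB ha
    have hca : c ≠ a := by rintro rfl; exact hAB.1 ha
    have hce : (B.erase a).card + 1 = B.card := Finset.card_erase_add_one ha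
    obtain ⟨f, h1, h2, h3, h4, h5, -⟩ := ih a (B.erase a) haA (by simp)
      (hAB.2.mono_right (Finset.erase_subset _ _)) (by omega) hAR.2
      (fun w hw => hBR w (Finset.mem_of_mem_erase hw)) (hBR a ha)
    have hB' : ∀ {w}, w ∉ B → w ∉ B.erase a := fun h h' => h (Finset.mem_of_mem_erase h')
    have hT := Realizes.toffoli (R := R) (t := t) hca (Ne.symm htA.1) hta.symm hAR.1 (hBR a ha) htR
    have hfc : ∀ x, f x c = x c := fun x => h4 x c hca (hB' hAB.1)
    have hft : ∀ x, f x t = x t := fun x => h4 x t hta (hB' htB)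
    have hfA : ∀ x, allOn A (f x) = allOn A x := fun x => allOn_congr fun w hw =>
      h4 x w (by rintro rfl; exact haA hw) (hB' (Finset.disjoint_left.1 hAB.2 hw))
    -- The dirty ancilla `a` receives the conjunction of `A` between two Toffoli gates onto `t`. Its
    -- unknown initial value contributes to both and cancels, leaving `x c` times the conjunction.
    -- Moving the write to `t` past `f` uses that `f` commutes with overwriting qubits it does not
    -- involve.
    have key : ∀ x, condNot t (fun x => x c && x a) (f (condNot t (fun x => x c && x a) x)) =
        Function.update (f x) t (xor (x t) (x c && allOn A x)) := by
      intro x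
      simp only [condNot, h5 _ _ _ hta htA.2 (hB' htB), Function.update_self,
        Function.update_idem, Function.update_of_ne (Ne.symm htA.1),
        Function.update_of_ne hta.symm, hfc, h3, allOn_update htA.2]
      cases x c <;> cases x a <;> cases allOn A x <;> simp
    have hTT : ∀ x : W → Bool,
        condNot t (fun x => x c && x a) (condNot t (fun x => x c && x a) x) = x :=
      condNot_condNot fun x b => by
        simp [Function.update_of_ne (Ne.symm htA.1), Function.update_of_ne hta.symm]
    have hR := hT.comp (h1.comp hT)
    refine ⟨_, hR.mono (by omega), fun x => ?_, fun x => ?_, fun x w hw hwB => ?_,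
      fun x u b hut huA huB => ?_, ?_⟩
    · simp only [hTT, h2]
    · rw [key, Function.update_self, allOn_insert]
    · rw [key, Function.update_of_ne hw, h4 x w (by rintro rfl; exact hwB ha) (hB' hwB)]
    · have hua : u ≠ a := by rintro rfl; exact huB ha
      rw [key, key, h5 x u b hua huA.2 (hB' huB), allOn_update huA.2,
        Function.update_of_ne (Ne.symm huA.1), Function.update_of_ne hut.symm,
        Function.update_comm hut.symm]
    -- Applying the inner ladder once more restores all ancillas, since it is an involution that
    -- neither reads nor changes `t`.
    · refine Eq.subst (motive := fun f => Realizes R _ (permMat f)) (funext fun x => ?_)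
        ((hR.comp h1).mono (by omega))
      rw [key, h2, hft, hfc, hfA, condNot, allOn_insert]

/-- Multiply controlled NOT with dirty ancillas. -/
theorem Realizes.condNot_allOn_of_dirty {R : Set W} {A B : Finset W} {t : W} (htA : t ∉ A)
    (htB : t ∉ B) (hAB : Disjoint A B) (hcard : A.card ≤ B.card + 1) (hA : ∀ w ∈ A, w ∈ R)
    (hB : ∀ w ∈ B, w ∈ R) (ht : t ∈ R) :
    Realizes R (76 * A.card + 2) (permMat (condNot t (allOn A))) := by
  rcases A.eq_empty_or_nonempty with rfl | hne
  · have e : (allOn ∅ : (W → Bool) → Bool) = fun _ => true := funext allOn_empty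
    rw [e]
    exact (Realizes.not ht).mono (by omega)
  · have := hne.card_pos
    obtain ⟨B', hB', hc⟩ := Finset.exists_subset_card_eq (s := B) (n := A.card - 1) (by omega)
    obtain ⟨_, -, -, -, -, -, h⟩ := exists_toffoli_ladder (R := R) hne t B' htA
      (fun h => htB (hB' h)) (hAB.mono_right hB') (by omega) hA (fun w hw => hB w (hB' hw)) ht
    exact h.mono (by omega)

/-- The controls are split into halves whose sizes differ by at most one. While one half controls a
NOT on `t`, the other half is idle and supplies enough dirty ancillas for the Toffoli ladder. -/
theorem Realizes.ctrlRot_linear {R : Set W} {S : Finset W} {t : W} (hS : ∀ w ∈ S, w ∈ R)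
    (ht : t ∈ R) (htS : t ∉ S) {w : ℂ} (hw : ‖w‖ = 1) :
    Realizes R (152 * S.card + 12) (_root_.ctrlRot S t w) := by
  obtain ⟨A, hA, hc⟩ := Finset.exists_subset_card_eq (s := S) (n := S.card / 2) (by omega)
  have hc' := Finset.card_sdiff_add_card_eq_card hA
  have h1 : Realizes R (76 * A.card + 2) (permMat (condNot t (allOn A))) :=
    Realizes.condNot_allOn_of_dirty (B := S \ A) (fun h => htS (hA h)) (by simp [htS])
      Finset.disjoint_sdiff (by omega) (fun w hw => hS w (hA hw))
      (fun w hw => hS w (Finset.sdiff_subset hw)) ht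
  have h2 : Realizes R (76 * (S \ A).card + 2) (permMat (condNot t (allOn (S \ A)))) :=
    Realizes.condNot_allOn_of_dirty (B := A) (by simp [htS]) (fun h => htS (hA h))
      Finset.sdiff_disjoint (by omega) (fun w hw => hS w (Finset.sdiff_subset hw))
      (fun w hw => hS w (hA hw)) ht
  have h := Realizes.ctrlRot ht (fun h => htS (hA h)) (by simp [htS]) h1 h2 hw
  rw [Finset.union_sdiff_of_subset hA] at h
  exact h.mono (by omega)

theorem Realizes.ctrlPhase {R : Set W} {S : Finset W} (hne : S.Nonempty) :
    (∀ w ∈ S, w ∈ R) → ∀ {z : ℂ}, ‖z‖ = 1 →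
      Realizes R (152 * S.card ^ 2) (_root_.ctrlPhase S z) := by
  induction hne using Finset.Nonempty.cons_induction with
  | singleton c =>
    intro hS z hz
    exact (Realizes.ctrlPhase_singleton (hS c (by simp)) hz).mono (by simp)
  | cons c S hc hne ih =>
    intro hS z hz
    obtain ⟨w, hw, rfl⟩ := exists_unit_pow_eq hz (m := 2) (by norm_num)
    have hw0 : w ≠ 0 := by rintro rfl; simp at hw
    rw [Finset.cons_eq_insert] at *
    simp only [Finset.mem_insert, forall_eq_or_imp] at hS
    rw [ctrlPhase_insert hw0, Finset.card_insert_of_notMem hc]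
    refine ((Realizes.ctrlRot_linear hS.2 hS.1 hc hw).mul (ih hS.2 hw)).mono ?_
    ring_nf
    omega

/-- Multiply controlled NOT without ancillas, in quadratic depth. -/
theorem Realizes.condNot_allOn {R : Set W} {S : Finset W} {t : W} (hS : ∀ w ∈ S, w ∈ R)
    (ht : t ∈ R) (htS : t ∉ S) :
    Realizes R (154 * (S.card + 1) ^ 2) (permMat (condNot t (allOn S))) := by
  have h := Realizes.ctrlPhase (R := R) (Finset.insert_nonempty t S)
    (by simpa using ⟨ht, hS⟩) (z := -1) (by simp)
  refine (Realizes.condNot_allOn_of_ctrlPhase ht htS h).mono ?_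
  rw [Finset.card_insert_of_notMem htS]
  have : 1 ≤ (S.card + 1) ^ 2 := Nat.one_le_pow _ _ (by omega)
  omega

/-- The qubits of `S` carry the values prescribed by `v`. -/
def cube (S : Finset W) (v : W → Bool) (x : W → Bool) : Bool := decide (∀ w ∈ S, x w = v w)

theorem cube_eq_true {S : Finset W} {v x : W → Bool} :
    cube S v x = true ↔ ∀ w ∈ S, x w = v w := by simp [cube]

theorem Realizes.negate {R : Set W} {S : Finset W} (v : W → Bool) (hS : ∀ w ∈ S, w ∈ R) :
    Realizes R S.card (permMat fun x w => if w ∈ S then xor (x w) (!v w) else x w) := by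
  induction S using Finset.induction_on with
  | empty => simpa using Realizes.id R
  | insert c S hc ih =>
    simp only [Finset.mem_insert, forall_eq_or_imp] at hS
    have h : Realizes R 1 (permMat (condNot c fun _ => !v c)) := by
      cases hv : v c
      · exact Realizes.not hS.1
      · refine Eq.subst (motive := fun f => Realizes R 1 (permMat f)) (funext fun x => ?_)
          ((Realizes.id R).mono zero_le_one)
        simp [condNot]
    rw [Finset.card_insert_of_notMem hc]
    refine Eq.subst (motive := fun f => Realizes R _ (permMat f)) (funext fun x => ?_)
      ((ih hS.2).comp h)
    funext w
    by_cases hw : w = c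
    · subst hw
      simp [hc, condNot_self]
    · simp [hw, condNot_of_ne]

/-- Conjugation by NOTs on the qubits that should be `false` reduces to the case where all controls
are set. -/
theorem Realizes.condNot_cube {R : Set W} {S : Finset W} {t : W} (v : W → Bool)
    (hS : ∀ w ∈ S, w ∈ R) (ht : t ∈ R) (htS : t ∉ S) :
    Realizes R (156 * (S.card + 1) ^ 2) (permMat (condNot t (cube S v))) := by
  have h := (Realizes.negate v hS).comp ((Realizes.condNot_allOn hS ht htS).comp
    (Realizes.negate v hS))
  refine Eq.subst (motive := fun f => Realizes R _ (permMat f)) (funext fun x => ?_)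
    (h.mono ?_)
  · have e : allOn S (fun w => if w ∈ S then xor (x w) (!v w) else x w) = cube S v x := by
      rw [Bool.eq_iff_iff]
      simp only [allOn, cube, decide_eq_true_eq]
      refine forall₂_congr fun w hw => ?_
      cases x w <;> cases v w <;> simp [hw]
    funext w
    by_cases hw : w = t
    · subst hw
      simp only [htS, if_false, condNot_self, e]
    · by_cases hwS : w ∈ S <;> simp [hw, hwS, condNot_of_ne]
  · ring_nf
    nlinarith [S.card.zero_le]

/-- `P` is a condition independent of the qubits in `U`, and any qubit in `U` can be negated under
the conjunction of `P` and a prescription of values of other qubits in `U`, in depth `d`. -/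
structure IsControl (R : Set W) (U : Finset W) (d : ℕ) (P : (W → Bool) → Bool) : Prop where
  indep : ∀ x y, (∀ w, w ∉ U → x w = y w) → P x = P y
  realizes : ∀ t ∈ U, ∀ S ⊆ U, t ∉ S → ∀ v : W → Bool,
    Realizes R d (permMat (condNot t fun x => P x && cube S v x))

theorem cube_congr {S : Finset W} {v x y : W → Bool} (h : ∀ w ∈ S, x w = y w) :
    cube S v x = cube S v y := by
  rw [Bool.eq_iff_iff]
  simp only [cube_eq_true]
  exact forall₂_congr fun w hw => by rw [h w hw]

theorem isControl_true {R : Set W} {U : Finset W} (hU : ∀ w ∈ U, w ∈ R) :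
    IsControl R U (156 * U.card ^ 2) fun _ => true := by
  refine ⟨fun _ _ _ => rfl, fun t ht S hS htS v => ?_⟩
  simp only [Bool.true_and]
  refine (Realizes.condNot_cube v (fun w hw => hU w (hS hw)) (hU t ht) htS).mono ?_
  have : S.card + 1 ≤ U.card := by
    rw [← Finset.card_insert_of_notMem htS]
    exact Finset.card_le_card (Finset.insert_subset ht hS)
  gcongr

theorem IsControl.mono {R : Set W} {U U' : Finset W} {d d' : ℕ} {P : (W → Bool) → Bool}
    (h : IsControl R U d P) (hU : U' ⊆ U) (hd : d ≤ d') : IsControl R U' d' P :=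
  ⟨fun x y hxy => h.indep x y fun w hw => hxy w fun h => hw (hU h),
    fun t ht S hS htS v => (h.realizes t (hU ht) S (hS.trans hU) htS v).mono hd⟩

/-- Fixing values of qubits in `U` costs nothing: the prescription is merged into the one that `P`
already admits. The qubits so used are withdrawn from `U`. -/
theorem IsControl.and_cube {R : Set W} {U U' T : Finset W} {d : ℕ} {P : (W → Bool) → Bool}
    (h : IsControl R U d P) (hT : T ⊆ U) (hU : U' ⊆ U) (hTU : Disjoint T U') (v : W → Bool) :
    IsControl R U' d fun x => P x && cube T v x := by
  refine ⟨fun x y hxy => ?_, fun t ht S hS htS v' => ?_⟩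
  · rw [h.indep x y fun w hw => hxy w fun h => hw (hU h),
      cube_congr fun w hw => hxy w (Finset.disjoint_left.1 hTU hw)]
  · have := h.realizes t (hU ht) (T ∪ S) (Finset.union_subset hT (hS.trans hU))
      (by
        rw [Finset.mem_union, not_or]
        exact ⟨fun h => Finset.disjoint_left.1 hTU h ht, htS⟩)
      (fun w => if w ∈ T then v w else v' w)
    refine Eq.subst (motive := fun f => Realizes R _ (permMat (condNot t f)))
      (funext fun x => ?_) this
    rw [Bool.and_assoc]
    congr 1
    rw [Bool.eq_iff_iff, Bool.and_eq_true]
    simp only [cube_eq_true, Finset.mem_union, or_imp, forall_and]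
    refine and_congr (forall₂_congr fun w hw => by simp [hw]) (forall₂_congr fun w hw => ?_)
    simp [Finset.disjoint_right.1 hTU (hS hw)]

/-- One CNOT writes the parity of `u` and `v` into `v`, where it becomes a one-qubit prescription,
and a second CNOT undoes this. Since `P` does not depend on the qubits in `U`, overwriting `v`
leaves it intact. The cost is only additive, so nested comparisons stay cheap. -/
theorem IsControl.and_xor {R : Set W} {U U' : Finset W} {d : ℕ} {P : (W → Bool) → Bool}
    (h : IsControl R U d P) {u v : W} (huv : u ≠ v) (hu : u ∈ U) (hv : v ∈ U) (huR : u ∈ R)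
    (hvR : v ∈ R) (hU : U' ⊆ U) (hu' : u ∉ U') (hv' : v ∉ U') (b : Bool) :
    IsControl R U' (d + 2) fun x => P x && (xor (x u) (x v) == b) := by
  refine ⟨fun x y hxy => ?_, fun t ht S hS htS val => ?_⟩
  · rw [h.indep x y fun w hw => hxy w fun h => hw (hU h), hxy u hu', hxy v hv']
  · have htu : t ≠ u := by rintro rfl; exact hu' ht
    have htv : t ≠ v := by rintro rfl; exact hv' ht
    have hvS : v ∉ S := fun h => hv' (hS h)
    have h1 := h.realizes t (hU ht) (insert v S)
      (Finset.insert_subset hv (hS.trans hU)) (by simp [htv, htS])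
      (Function.update val v b)
    have hc := Realizes.cnot huv huR hvR
    refine Eq.subst (motive := fun f => Realizes R _ (permMat f)) (funext fun x => ?_)
      ((hc.comp (h1.comp hc)).mono (by omega))
    have e : (P (condNot v (fun x => x u) x) && cube (insert v S) (Function.update val v b)
        (condNot v (fun x => x u) x)) = (P x && (xor (x u) (x v) == b) && cube S val x) := by
      rw [h.indep _ x fun w hw => condNot_of_ne _ _ (by rintro rfl; exact hw hv), Bool.and_assoc]
      congr 1
      rw [Bool.eq_iff_iff, Bool.and_eq_true]
      simp only [cube_eq_true, Finset.mem_insert, forall_eq_or_imp, condNot_self,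
        Function.update_self, beq_iff_eq, Bool.xor_comm (x u)]
      refine and_congr Iff.rfl (forall₂_congr fun w hw => ?_)
      have : w ≠ v := by rintro rfl; exact hvS hw
      simp [condNot_of_ne, this]
    funext w
    by_cases hwv : w = v
    · subst hwv
      rw [condNot_self, condNot_of_ne _ _ htv.symm, condNot_of_ne _ _ htu.symm,
        condNot_of_ne _ _ htv.symm, condNot_self, condNot_of_ne _ _ huv]
      cases x w <;> cases x u <;> rfl
    · rw [condNot_of_ne _ _ hwv]
      by_cases hwt : w = t
      · subst hwt
        rw [condNot_self, condNot_self, e, condNot_of_ne _ _ hwv]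
      · simp only [condNot_of_ne _ _ hwt, condNot_of_ne _ _ hwv]

/-! Reversible arithmetic on registers: `A 0, A 1, …` are the qubits of a register, the least
significant one first. -/

/-- The number stored in the first `r` qubits of the register `A`. -/
def readNat (A : ℕ → W) (x : W → Bool) : ℕ → ℕ
  | 0 => 0
  | r + 1 => readNat A x r + 2 ^ r * (x (A r)).toNat

theorem readNat_lt (A : ℕ → W) (x : W → Bool) (r : ℕ) : readNat A x r < 2 ^ r := by
  induction r with
  | zero => simp [readNat]
  | succ r ih =>
    rw [readNat, pow_succ]
    cases x (A r) <;> simp <;> omega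

theorem readNat_congr {A B : ℕ → W} {x y : W → Bool} {r : ℕ}
    (h : ∀ j < r, x (A j) = y (B j)) : readNat A x r = readNat B y r := by
  induction r with
  | zero => rfl
  | succ r ih => rw [readNat, readNat, ih fun j hj => h j (by omega), h r (by omega)]

theorem readNat_add_one_eq_iff {A : ℕ → W} {x : W → Bool} {r : ℕ} :
    readNat A x r + 1 = 2 ^ r ↔ ∀ j < r, x (A j) = true := by
  induction r with
  | zero => simp [readNat]
  | succ r ih =>
    rw [readNat, pow_succ, Nat.forall_lt_succ_right, ← ih]
    have := readNat_lt A x r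
    cases x (A r) <;> simp <;> omega

theorem readNat_testBit {A : ℕ → W} {x : W → Bool} {r j : ℕ} (hj : j < r) :
    (readNat A x r).testBit j = x (A j) := by
  induction r with
  | zero => omega
  | succ r ih =>
    rw [readNat, add_comm]
    rcases Nat.lt_succ_iff_lt_or_eq.1 hj with h | rfl
    · rw [Nat.testBit_two_pow_mul_add _ (readNat_lt A x r), if_pos h, ih h]
    · rw [Nat.testBit_two_pow_mul_add _ (readNat_lt A x j), if_neg (lt_irrefl _)]
      cases x (A j) <;> simp

theorem readNat_eq {A : ℕ → W} {x : W → Bool} {r m : ℕ} (hm : m < 2 ^ r)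
    (h : ∀ j < r, x (A j) = m.testBit j) : readNat A x r = m := by
  refine Nat.eq_of_testBit_eq fun j => ?_
  rcases lt_or_ge j r with hj | hj
  · rw [readNat_testBit hj, h j hj]
  · have hp : 2 ^ r ≤ 2 ^ j := Nat.pow_le_pow_right (by norm_num) hj
    rw [Nat.testBit_lt_two_pow ((readNat_lt A x r).trans_le hp),
      Nat.testBit_lt_two_pow (hm.trans_le hp)]

/-- The first `r` qubits of the register `A`. -/
def digitWires (A : ℕ → W) (r : ℕ) : Finset W := (Finset.range r).image A

theorem mem_digitWires {A : ℕ → W} {r : ℕ} {w : W} :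
    w ∈ digitWires A r ↔ ∃ j < r, A j = w := by simp [digitWires]

theorem digitWires_succ (A : ℕ → W) (r : ℕ) :
    digitWires A (r + 1) = insert (A r) (digitWires A r) := by
  rw [digitWires, Finset.range_add_one, Finset.image_insert, digitWires]

theorem digitWires_mono (A : ℕ → W) {r s : ℕ} (h : r ≤ s) : digitWires A r ⊆ digitWires A s := by
  intro w hw
  obtain ⟨j, hj, rfl⟩ := mem_digitWires.1 hw
  exact mem_digitWires.2 ⟨j, hj.trans_le h, rfl⟩

theorem self_mem_digitWires (A : ℕ → W) {j r : ℕ} (h : j < r) : A j ∈ digitWires A r :=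
  mem_digitWires.2 ⟨j, h, rfl⟩

theorem notMem_digitWires {A : ℕ → W} {r s : ℕ}
    (hA : ∀ i < s, ∀ j < s, A i = A j → i = j) (h : r < s) : A r ∉ digitWires A r := by
  intro hw
  obtain ⟨j, hj, e⟩ := mem_digitWires.1 hw
  have := hA j (by omega) r h e
  omega

theorem cube_digitWires_true {A : ℕ → W} {r : ℕ} {x : W → Bool} :
    cube (digitWires A r) (fun _ => true) x = true ↔ readNat A x r + 1 = 2 ^ r := by
  rw [readNat_add_one_eq_iff, cube_eq_true]
  simp [digitWires]

/-- Changing the next qubit leaves the number in the first `r` qubits unchanged. -/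
theorem readNat_condNot {A : ℕ → W} {r : ℕ} (hr : A r ∉ digitWires A r) (P : (W → Bool) → Bool)
    (x : W → Bool) : readNat A (condNot (A r) P x) r = readNat A x r :=
  readNat_congr fun j hj => condNot_of_ne _ _ fun h => hr (mem_digitWires.2 ⟨j, hj, h⟩)

/-- The low bits are decremented first. A borrow has occurred exactly when they are then all ones,
so this pattern controls the flip of the next bit. Wrapping around at zero is part of the statement
because the recursion needs it. -/
theorem exists_condDec {R : Set W} {U : Finset W} {d : ℕ} {P : (W → Bool) → Bool}
    (hP : IsControl R U d P) (A : ℕ → W) (r : ℕ) :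
    digitWires A r ⊆ U → (∀ i < r, ∀ j < r, A i = A j → i = j) →
      ∃ f : (W → Bool) → (W → Bool), Realizes R (r * d) (permMat f) ∧ ∀ x,
        (∀ w ∉ digitWires A r, f x w = x w) ∧ (P x = false → f x = x) ∧
        (P x = true → (readNat A x r = 0 → readNat A (f x) r + 1 = 2 ^ r) ∧
          (readNat A x r ≠ 0 → readNat A (f x) r + 1 = readNat A x r)) := by
  induction r with
  | zero =>
    intro _ _
    exact ⟨fun x => x, by simpa using Realizes.id R, fun x => by simp [readNat]⟩
  | succ r ih =>
    intro hU hA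
    have hr := notMem_digitWires hA (Nat.lt_succ_self r)
    rw [digitWires_succ, Finset.insert_subset_iff] at hU
    obtain ⟨f, hf, hfx⟩ := ih hU.2 fun i hi j hj => hA i (by omega) j (by omega)
    have hg := hP.realizes (A r) hU.1 (digitWires A r) hU.2 hr fun _ => true
    refine ⟨_, (hg.comp hf).mono (by ring_nf; omega), fun x => ?_⟩
    obtain ⟨h1, h2, h3⟩ := hfx x
    have hPf : P (f x) = P x := hP.indep _ _ fun w hw => h1 w fun h => hw (hU.2 h)
    refine ⟨fun w hw => ?_, fun h => ?_, fun h => ?_⟩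
    · rw [digitWires_succ, Finset.mem_insert, not_or] at hw
      rw [condNot_of_ne _ _ hw.1, h1 w hw.2]
    · rw [condNot, h2 h]
      simp [h]
    · have h4 := h3 h
      rw [readNat, readNat, readNat_condNot hr, condNot_self, hPf, h, Bool.true_and, h1 _ hr,
        pow_succ]
      have h5 := readNat_lt A x r
      cases hc : cube (digitWires A r) (fun _ => true) (f x)
      · have hc' : ¬ (readNat A (f x) r + 1 = 2 ^ r) := by
          rw [← cube_digitWires_true, hc]; simp
        cases x (A r) <;> simp <;> omega
      · have hc' := cube_digitWires_true.1 hc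
        cases x (A r) <;> simp <;> omega

/-- Here the carry is visible before the low bits change, so the next bit is flipped first. -/
theorem exists_condInc {R : Set W} {U : Finset W} {d : ℕ} {P : (W → Bool) → Bool}
    (hP : IsControl R U d P) (A : ℕ → W) (r : ℕ) :
    digitWires A r ⊆ U → (∀ i < r, ∀ j < r, A i = A j → i = j) →
      ∃ f : (W → Bool) → (W → Bool), Realizes R (r * d) (permMat f) ∧ ∀ x,
        (∀ w ∉ digitWires A r, f x w = x w) ∧ (P x = false → f x = x) ∧
        (P x = true → (readNat A x r + 1 = 2 ^ r → readNat A (f x) r = 0) ∧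
          (readNat A x r + 1 ≠ 2 ^ r → readNat A (f x) r = readNat A x r + 1)) := by
  induction r with
  | zero =>
    intro _ _
    exact ⟨fun x => x, by simpa using Realizes.id R, fun x => by simp [readNat]⟩
  | succ r ih =>
    intro hU hA
    have hr := notMem_digitWires hA (Nat.lt_succ_self r)
    rw [digitWires_succ, Finset.insert_subset_iff] at hU
    obtain ⟨f, hf, hfx⟩ := ih hU.2 fun i hi j hj => hA i (by omega) j (by omega)
    have hg := hP.realizes (A r) hU.1 (digitWires A r) hU.2 hr fun _ => true
    refine ⟨_, (hf.comp hg).mono (by ring_nf; omega), fun x => ?_⟩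
    set y := condNot (A r) (fun x => P x && cube (digitWires A r) (fun _ => true) x) x with hy
    obtain ⟨h1, h2, h3⟩ := hfx y
    have hPy : P y = P x := hP.indep _ _ fun w hw =>
      condNot_of_ne _ _ (by rintro rfl; exact hw hU.1)
    refine ⟨fun w hw => ?_, fun h => ?_, fun h => ?_⟩
    · rw [digitWires_succ, Finset.mem_insert, not_or] at hw
      rw [h1 w hw.2, hy, condNot_of_ne _ _ hw.1]
    · rw [h2 (hPy.trans h), hy, condNot]
      simp [h]
    · have h4 := h3 (hPy.trans h)
      rw [hy, readNat_condNot hr, ← hy] at h4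
      rw [readNat, readNat, h1 _ hr, hy, condNot_self, h, Bool.true_and, ← hy, pow_succ]
      have h5 := readNat_lt A x r
      cases hc : cube (digitWires A r) (fun _ => true) x
      · have hc' : ¬ (readNat A x r + 1 = 2 ^ r) := by
          rw [← cube_digitWires_true, hc]; simp
        cases x (A r) <;> simp <;> omega
      · have hc' := cube_digitWires_true.1 hc
        cases x (A r) <;> simp <;> omega

/-- A swap is three CNOTs, each under the additional control `P`. -/
theorem exists_condSwap_qubits {R : Set W} {U : Finset W} {d : ℕ} {P : (W → Bool) → Bool}
    (hP : IsControl R U d P) {u v : W} (huv : u ≠ v) (hu : u ∈ U) (hv : v ∈ U) :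
    ∃ f : (W → Bool) → (W → Bool), Realizes R (3 * d) (permMat f) ∧ ∀ x,
      (∀ w, w ≠ u → w ≠ v → f x w = x w) ∧ (P x = false → f x = x) ∧
      (P x = true → f x u = x v ∧ f x v = x u) := by
  have h1 := hP.realizes u hu {v} (by simpa using hv) (by simpa using huv) fun _ => true
  have h2 := hP.realizes v hv {u} (by simpa using hu) (by simpa using huv.symm) fun _ => true
  have e : ∀ w (x : W → Bool), cube {w} (fun _ => true) x = x w := fun w x => by
    rw [Bool.eq_iff_iff]; simp [cube]
  have hi : ∀ w ∈ U, ∀ (x : W → Bool) b, P (Function.update x w b) = P x := fun w hw x b =>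
    hP.indep _ _ fun w' hw' => Function.update_of_ne (by rintro rfl; exact hw' hw) _ _
  refine ⟨_, (h1.comp (h2.comp h1)).mono (by omega), fun x => ⟨fun w hwu hwv => ?_, fun h => ?_,
    fun h => ?_⟩⟩
  · rw [condNot_of_ne _ _ hwu, condNot_of_ne _ _ hwv, condNot_of_ne _ _ hwu]
  · simp [condNot, h]
  · simp only [e, condNot, hi u hu, hi v hv, h, Bool.true_and, Function.update_self,
      Function.update_of_ne huv, Function.update_of_ne huv.symm]
    cases x u <;> cases x v <;> simp

theorem exists_condSwap {R : Set W} {U : Finset W} {d : ℕ} {P : (W → Bool) → Bool}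
    (hP : IsControl R U d P) (A B : ℕ → W) (r : ℕ) :
    digitWires A r ∪ digitWires B r ⊆ U → (∀ i < r, ∀ j < r, A i = A j → i = j) →
      (∀ i < r, ∀ j < r, B i = B j → i = j) → (∀ i < r, ∀ j < r, A i ≠ B j) →
      ∃ f : (W → Bool) → (W → Bool), Realizes R (r * (3 * d)) (permMat f) ∧ ∀ x,
        (∀ w ∉ digitWires A r ∪ digitWires B r, f x w = x w) ∧ (P x = false → f x = x) ∧
        (P x = true → ∀ j < r, f x (A j) = x (B j) ∧ f x (B j) = x (A j)) := by
  induction r with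
  | zero =>
    intro _ _ _ _
    exact ⟨fun x => x, by simpa using Realizes.id R, fun x => by simp⟩
  | succ r ih =>
    intro hU hA hB hAB
    have hrA := notMem_digitWires hA (Nat.lt_succ_self r)
    have hrB := notMem_digitWires hB (Nat.lt_succ_self r)
    have hU' : digitWires A r ∪ digitWires B r ⊆ U :=
      (Finset.union_subset_union (digitWires_mono A (Nat.le_succ r))
        (digitWires_mono B (Nat.le_succ r))).trans hU
    have hAr : A r ∈ U := hU (Finset.mem_union_left _ (self_mem_digitWires A (Nat.lt_succ_self r)))
    have hBr : B r ∈ U := hU (Finset.mem_union_right _ (self_mem_digitWires B (Nat.lt_succ_self r)))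
    obtain ⟨f, hf, hfx⟩ := ih hU' (fun i hi j hj => hA i (by omega) j (by omega))
      (fun i hi j hj => hB i (by omega) j (by omega))
      (fun i hi j hj => hAB i (by omega) j (by omega))
    obtain ⟨g, hg, hgx⟩ := exists_condSwap_qubits hP (hAB r (by omega) r (by omega)) hAr hBr
    refine ⟨_, (hg.comp hf).mono (by ring_nf; omega), fun x => ?_⟩
    obtain ⟨h1, h2, h3⟩ := hfx x
    obtain ⟨g1, g2, g3⟩ := hgx (f x)
    have hPf : P (f x) = P x := hP.indep _ _ fun w hw => h1 w fun h => hw (hU' h)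
    have hA' : A r ∉ digitWires A r ∪ digitWires B r := by
      rw [Finset.mem_union, not_or]
      refine ⟨hrA, fun h => ?_⟩
      obtain ⟨j, hj, e⟩ := mem_digitWires.1 h
      exact hAB r (by omega) j (by omega) e.symm
    have hB' : B r ∉ digitWires A r ∪ digitWires B r := by
      rw [Finset.mem_union, not_or]
      refine ⟨fun h => ?_, hrB⟩
      obtain ⟨j, hj, e⟩ := mem_digitWires.1 h
      exact hAB j (by omega) r (by omega) e
    refine ⟨fun w hw => ?_, fun h => ?_, fun h j hj => ?_⟩
    · simp only [digitWires_succ, Finset.mem_union, Finset.mem_insert, not_or] at hw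
      rw [g1 w hw.1.1 hw.2.1, h1 w (by simp [hw])]
    · rw [g2 (hPf.trans h), h2 h]
    · rcases Nat.lt_succ_iff_lt_or_eq.1 hj with h' | rfl
      · rw [g1 _ (fun e => by have := hA _ hj r (by omega) e; omega) (hAB _ hj _ (by omega)),
          g1 _ (hAB _ (by omega) _ hj).symm (fun e => by have := hB _ hj r (by omega) e; omega)]
        exact h3 h j h'
      · have := g3 (hPf.trans h)
        rwa [h1 _ hA', h1 _ hB'] at this

/-- The rule `(a, b) ↦ (b, a - 1)` for `b < a` and `(a, b) ↦ (b + 1, a)` for `a ≤ b`, made into a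
bijection of pairs of numbers below `T` by fixing the pairs `(a, T - 1)`. -/
def LehmerStep (T a b a' b' : ℕ) : Prop :=
  (b < a → a' = b ∧ b' + 1 = a) ∧ (a ≤ b → b + 1 ≠ T → a' = b + 1 ∧ b' = a) ∧
    (b + 1 = T → a' = a ∧ b' = b)

/-- Arithmetic behind the recursion, with `α`, `β` the leading bits. For equal leading bits the step
acts on the low parts. For `α = 1`, `β = 0` the pair becomes `(b, a - 1)`, by a decrement before the
swap; for `α = 0`, `β = 1` it becomes `(b + 1, a)`, by an increment after it. The flip of `β` when
`α = 0` and the low part of `b` is maximal handles the boundary. At the start it sends an increment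
that overflows from the low part to the case of different leading bits, and the fixed pairs with `b
= 2T - 1` and `α = 0` to the case of equal ones. At the end it restores these fixed pairs and
propagates the borrow of the decrement. -/
theorem lehmerStep_succ {T a b a1 b1 a2 b2 a3 b3 a4 b4 a5 b5 a6 b6 a7 b7 : ℕ}
    {α β α1 β1 α2 β2 α3 β3 α4 β4 α5 β5 α6 β6 α7 β7 : Bool} (la : a < T) (lb : b < T)
    (k : a1 = a ∧ b1 = b ∧ α1 = α ∧ (α = false → b + 1 = T → β1 = !β) ∧
      (¬ (α = false ∧ b + 1 = T) → β1 = β))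
    (f : α2 = α1 ∧ β2 = β1 ∧ (α1 ≠ β1 → a2 = a1 ∧ b2 = b1) ∧
      (α1 = β1 → LehmerStep T a1 b1 a2 b2))
    (d : α3 = α2 ∧ β3 = β2 ∧ b3 = b2 ∧ (¬ (α2 = true ∧ β2 = false) → a3 = a2) ∧
      (α2 = true → β2 = false → (a2 = 0 → a3 + 1 = T) ∧ (a2 ≠ 0 → a3 + 1 = a2)))
    (l : α4 = α3 ∧ β4 = β3 ∧ (α3 = β3 → a4 = a3 ∧ b4 = b3) ∧ (α3 ≠ β3 → a4 = b3 ∧ b4 = a3))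
    (s : a5 = a4 ∧ b5 = b4 ∧ α5 = β4 ∧ β5 = α4)
    (i : α6 = α5 ∧ β6 = β5 ∧ b6 = b5 ∧ (¬ (α5 = true ∧ β5 = false) → a6 = a5) ∧
      (α5 = true → β5 = false → (a5 + 1 = T → a6 = 0) ∧ (a5 + 1 ≠ T → a6 = a5 + 1)))
    (m : a7 = a6 ∧ b7 = b6 ∧ α7 = α6 ∧ (α6 = false → b6 + 1 = T → β7 = !β6) ∧
      (¬ (α6 = false ∧ b6 + 1 = T) → β7 = β6)) :
    LehmerStep (T * 2) (a + T * α.toNat) (b + T * β.toNat) (a7 + T * α7.toNat)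
      (b7 + T * β7.toNat) := by
  obtain ⟨rfl, rfl, rfl, k1, k2⟩ := k
  obtain ⟨rfl, rfl, f1, f2⟩ := f
  obtain ⟨rfl, rfl, rfl, d1, d2⟩ := d
  obtain ⟨rfl, rfl, l1, l2⟩ := l
  obtain ⟨rfl, rfl, rfl, rfl⟩ := s
  obtain ⟨rfl, rfl, rfl, i1, i2⟩ := i
  obtain ⟨rfl, rfl, rfl, m1, m2⟩ := m
  unfold LehmerStep at *
  cases α7 <;> cases β6 <;> cases β <;> cases β7 <;>
    simp only [Bool.toNat_true, Bool.toNat_false, ne_eq, reduceCtorEq, not_true_eq_false,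
      not_false_eq_true, forall_const, and_true, true_and,
      and_false, false_and, Bool.not_true, Bool.not_false, implies_true, IsEmpty.forall_iff,
      mul_zero, mul_one, add_zero] at * <;>
    grind

/-- The condition `P` is arbitrary so that the induction can add the test for equal leading bits to
it. Each level raises the control cost `d` by 2 and spends about `5 * r * d` besides the recursive
call, whence the bound. -/
theorem exists_lehmerStep {R : Set W} (A B : ℕ → W) (r : ℕ) :
    ∀ {d : ℕ} {P : (W → Bool) → Bool},
      IsControl R (digitWires A r ∪ digitWires B r) d P →
      (∀ i < r, A i ∈ R) → (∀ i < r, B i ∈ R) → (∀ i < r, ∀ j < r, A i = A j → i = j) →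
      (∀ i < r, ∀ j < r, B i = B j → i = j) → (∀ i < r, ∀ j < r, A i ≠ B j) →
      ∃ f : (W → Bool) → (W → Bool), Realizes R (5 * r ^ 2 * (d + 2 * r)) (permMat f) ∧ ∀ x,
        (∀ w ∉ digitWires A r ∪ digitWires B r, f x w = x w) ∧ (P x = false → f x = x) ∧
        (P x = true → LehmerStep (2 ^ r) (readNat A x r) (readNat B x r)
          (readNat A (f x) r) (readNat B (f x) r)) := by
  induction r with
  | zero =>
    intro d P hP _ _ _ _ _
    exact ⟨fun x => x, by simpa using Realizes.id R, fun x => by simp [readNat, LehmerStep]⟩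
  | succ r ih =>
    intro d P hP hAR hBR hA hB hAB
    set U' := digitWires A (r + 1) ∪ digitWires B (r + 1) with hU'def
    set U := digitWires A r ∪ digitWires B r with hUdef
    have hU : U ⊆ U' := Finset.union_subset_union (digitWires_mono A (Nat.le_succ r))
      (digitWires_mono B (Nat.le_succ r))
    have hrA := notMem_digitWires hA (Nat.lt_succ_self r)
    have hrB := notMem_digitWires hB (Nat.lt_succ_self r)
    have hAr' : A r ∈ U' := Finset.mem_union_left _ (self_mem_digitWires A (Nat.lt_succ_self r))
    have hBr' : B r ∈ U' := Finset.mem_union_right _ (self_mem_digitWires B (Nat.lt_succ_self r))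
    have hne : A r ≠ B r := hAB r (by omega) r (by omega)
    have hAB' : A r ∉ digitWires B r := fun h => by
      obtain ⟨j, hj, e⟩ := mem_digitWires.1 h
      exact hAB r (by omega) j (by omega) e.symm
    have hBA' : B r ∉ digitWires A r := fun h => by
      obtain ⟨j, hj, e⟩ := mem_digitWires.1 h
      exact hAB j (by omega) r (by omega) e
    have hAr : A r ∉ U := by
      rw [hUdef, Finset.mem_union, not_or]
      exact ⟨hrA, hAB'⟩
    have hBr : B r ∉ U := by
      rw [hUdef, Finset.mem_union, not_or]
      exact ⟨hBA', hrB⟩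
    have hA0 : ∀ i < r, ∀ j < r, A i = A j → i = j :=
      fun i hi j hj => hA i (by omega) j (by omega)
    have hB0 : ∀ i < r, ∀ j < r, B i = B j → i = j :=
      fun i hi j hj => hB i (by omega) j (by omega)
    have hAB0 : ∀ i < r, ∀ j < r, A i ≠ B j := fun i hi j hj => hAB i (by omega) j (by omega)
    have hAU : digitWires A r ⊆ U := Finset.subset_union_left
    -- the controls of the steps
    have hPeq := hP.and_xor hne hAr' hBr' (hAR r (by omega)) (hBR r (by omega)) hU hAr hBr false
    have hPne := hP.and_xor hne hAr' hBr' (hAR r (by omega)) (hBR r (by omega)) hU hAr hBr true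
    have hPab := hP.and_cube (T := {A r, B r}) (U' := U) (by
        intro w hw
        rcases Finset.mem_insert.1 hw with rfl | hw
        · exact hAr'
        · rwa [Finset.mem_singleton.1 hw]) hU (by
        rw [Finset.disjoint_insert_left, Finset.disjoint_singleton_left]
        exact ⟨hAr, hBr⟩) fun w => decide (w = A r)
    have hcab : ∀ x : W → Bool, cube {A r, B r} (fun w => decide (w = A r)) x =
        (x (A r) && !x (B r)) := by
      intro x
      rw [Bool.eq_iff_iff, cube_eq_true]
      simp [hne.symm]
    -- the steps
    obtain ⟨F, hF, hFx⟩ := ih hPeq (fun i hi => hAR i (by omega)) (fun i hi => hBR i (by omega))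
      hA0 hB0 hAB0
    obtain ⟨D, hD, hDx⟩ := exists_condDec hPab A r hAU hA0
    obtain ⟨I, hI, hIx⟩ := exists_condInc hPab A r hAU hA0
    obtain ⟨L, hL, hLx⟩ := exists_condSwap hPne A B r subset_rfl hA0 hB0 hAB0
    obtain ⟨S, hS, hSx⟩ := exists_condSwap_qubits hP hne hAr' hBr'
    -- The prescribed values are 0 at `A r` and 1 on all the low qubits of `B`.
    have hK := hP.realizes (B r) hBr' (insert (A r) (digitWires B r))
      (Finset.insert_subset hAr' (fun w hw => hU (Finset.mem_union_right _ hw)))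
      (by rw [Finset.mem_insert, not_or]; exact ⟨hne.symm, hrB⟩) fun w => decide (w ≠ A r)
    set K := condNot (B r) fun x => P x && cube (insert (A r) (digitWires B r))
      (fun w => decide (w ≠ A r)) x with hKdef
    have hcK : ∀ x : W → Bool, cube (insert (A r) (digitWires B r)) (fun w => decide (w ≠ A r)) x
        = true ↔ x (A r) = false ∧ readNat B x r + 1 = 2 ^ r := by
      intro x
      rw [readNat_add_one_eq_iff, cube_eq_true]
      simp only [Finset.mem_insert, forall_eq_or_imp, mem_digitWires, forall_exists_index, and_imp]
      refine and_congr (by simp) ⟨fun h j hj => ?_, ?_⟩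
      · rw [h _ j hj rfl]
        simpa using (hAB r (by omega) j (by omega)).symm
      · rintro h _ j hj rfl
        rw [h j hj]
        simpa using (hAB r (by omega) j (by omega)).symm
    -- effects of the steps
    have rA : ∀ {x y : W → Bool}, (∀ w ∉ digitWires B r, w ≠ A r → w ≠ B r → y w = x w) →
        readNat A y r = readNat A x r := fun h => readNat_congr fun j hj =>
      h _ (fun h' => by
        obtain ⟨i, hi, e⟩ := mem_digitWires.1 h'
        exact hAB0 j hj i hi e.symm)
        (fun e => by have := hA _ (by omega) _ (by omega) e; omega) (hAB j (by omega) r (by omega))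
    have rB : ∀ {x y : W → Bool}, (∀ w ∉ digitWires A r, w ≠ A r → w ≠ B r → y w = x w) →
        readNat B y r = readNat B x r := fun h => readNat_congr fun j hj =>
      h _ (fun h' => by
        obtain ⟨i, hi, e⟩ := mem_digitWires.1 h'
        exact hAB0 i hi j hj e)
        (hAB r (by omega) j (by omega)).symm
        (fun e => by have := hB _ (by omega) _ (by omega) e; omega)
    have Pc : ∀ {x y : W → Bool}, (∀ w ∉ U', y w = x w) → P y = P x := fun h => hP.indep _ _ h
    have eK : ∀ x, (∀ w ∉ U', K x w = x w) ∧ (P x = false → K x = x) ∧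
        (P x = true → readNat A (K x) r = readNat A x r ∧ readNat B (K x) r = readNat B x r ∧
          K x (A r) = x (A r) ∧
          (x (A r) = false → readNat B x r + 1 = 2 ^ r → K x (B r) = !x (B r)) ∧
          (¬ (x (A r) = false ∧ readNat B x r + 1 = 2 ^ r) → K x (B r) = x (B r))) := by
      intro x
      refine ⟨fun w hw => condNot_of_ne _ _ (by rintro rfl; exact hw hBr'), fun h => ?_,
        fun h => ⟨rA fun w _ _ h => condNot_of_ne _ _ h, rB fun w _ _ h => condNot_of_ne _ _ h,
          condNot_of_ne _ _ hne, fun h1 h2 => ?_, fun h1 => ?_⟩⟩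
      · rw [hKdef, condNot]
        simp [h]
      · rw [hKdef, condNot_self, h, (hcK x).2 ⟨h1, h2⟩]
        simp
      · rw [hKdef, condNot_self, h, Bool.eq_false_iff.2 (mt (hcK x).1 h1)]
        simp
    clear_value K
    have eF : ∀ x, (∀ w ∉ U', F x w = x w) ∧ (P x = false → F x = x) ∧
        (P x = true → F x (A r) = x (A r) ∧ F x (B r) = x (B r) ∧
          (x (A r) ≠ x (B r) →
            readNat A (F x) r = readNat A x r ∧ readNat B (F x) r = readNat B x r) ∧ (x (A r) = x (B r) →
            LehmerStep (2 ^ r) (readNat A x r) (readNat B x r)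
              (readNat A (F x) r) (readNat B (F x) r))) := by
      intro x
      obtain ⟨h1, h2, h3⟩ := hFx x
      exact ⟨fun w hw => h1 w fun h => hw (hU h), fun h => h2 (by simp [h]),
        fun h => ⟨h1 _ hAr, h1 _ hBr, fun h' => by simp [h2 (by simp [h, h'])],
          fun h' => h3 (by simp [h, h'])⟩⟩
    have eD : ∀ x, (∀ w ∉ U', D x w = x w) ∧ (P x = false → D x = x) ∧
        (P x = true → D x (A r) = x (A r) ∧ D x (B r) = x (B r) ∧
          readNat B (D x) r = readNat B x r ∧ (¬ (x (A r) = true ∧ x (B r) = false) →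
            readNat A (D x) r = readNat A x r) ∧
          (x (A r) = true → x (B r) = false →
            (readNat A x r = 0 → readNat A (D x) r + 1 = 2 ^ r) ∧
            (readNat A x r ≠ 0 → readNat A (D x) r + 1 = readNat A x r))) := by
      intro x
      obtain ⟨h1, h2, h3⟩ := hDx x
      rw [hcab] at h2 h3
      exact ⟨fun w hw => h1 w fun h => hw (hU (hAU h)), fun h => h2 (by simp [h]),
        fun h => ⟨h1 _ hrA, h1 _ hBA', rB fun w hw _ _ => h1 w hw,
          fun h' => by rw [h2 (by simpa [h] using h')], fun ha hb => h3 (by simp [h, ha, hb])⟩⟩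
    have eI : ∀ x, (∀ w ∉ U', I x w = x w) ∧ (P x = false → I x = x) ∧
        (P x = true → I x (A r) = x (A r) ∧ I x (B r) = x (B r) ∧
          readNat B (I x) r = readNat B x r ∧ (¬ (x (A r) = true ∧ x (B r) = false) →
            readNat A (I x) r = readNat A x r) ∧
          (x (A r) = true → x (B r) = false →
            (readNat A x r + 1 = 2 ^ r → readNat A (I x) r = 0) ∧
            (readNat A x r + 1 ≠ 2 ^ r → readNat A (I x) r = readNat A x r + 1))) := by
      intro x
      obtain ⟨h1, h2, h3⟩ := hIx x
      rw [hcab] at h2 h3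
      exact ⟨fun w hw => h1 w fun h => hw (hU (hAU h)), fun h => h2 (by simp [h]),
        fun h => ⟨h1 _ hrA, h1 _ hBA', rB fun w hw _ _ => h1 w hw,
          fun h' => by rw [h2 (by simpa [h] using h')], fun ha hb => h3 (by simp [h, ha, hb])⟩⟩
    have eL : ∀ x, (∀ w ∉ U', L x w = x w) ∧ (P x = false → L x = x) ∧
        (P x = true → L x (A r) = x (A r) ∧ L x (B r) = x (B r) ∧
          (x (A r) = x (B r) →
            readNat A (L x) r = readNat A x r ∧ readNat B (L x) r = readNat B x r) ∧ (x (A r) ≠ x (B r) →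
            readNat A (L x) r = readNat B x r ∧ readNat B (L x) r = readNat A x r)) := by
      intro x
      obtain ⟨h1, h2, h3⟩ := hLx x
      exact ⟨fun w hw => h1 w fun h => hw (hU h), fun h => h2 (by simp [h]),
        fun h => ⟨h1 _ hAr, h1 _ hBr, fun h' => by simp [h2 (by simp [h, h'])],
          fun h' => ⟨readNat_congr fun j hj => (h3 (by simp [h, h']) j hj).1,
            readNat_congr fun j hj => (h3 (by simp [h, h']) j hj).2⟩⟩⟩
    have eS : ∀ x, (∀ w ∉ U', S x w = x w) ∧ (P x = false → S x = x) ∧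
        (P x = true → readNat A (S x) r = readNat A x r ∧ readNat B (S x) r = readNat B x r ∧
          S x (A r) = x (B r) ∧ S x (B r) = x (A r)) := by
      intro x
      obtain ⟨h1, h2, h3⟩ := hSx x
      exact ⟨fun w hw => h1 w (by rintro rfl; exact hw hAr') (by rintro rfl; exact hw hBr'), h2,
        fun h => ⟨rA fun w _ => h1 w, rB fun w _ => h1 w, h3 h⟩⟩
    refine ⟨fun x => K (I (S (L (D (F (K x)))))), ?_, fun x => ⟨fun w hw => ?_, fun h => ?_,
      fun h => ?_⟩⟩
    · refine (hK.comp (hI.comp (hS.comp (hL.comp (hD.comp (hF.comp hK)))))).mono ?_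
      ring_nf
      nlinarith [Nat.zero_le (r * d), Nat.zero_le (r ^ 2), Nat.zero_le d, Nat.zero_le (r ^ 3)]
    · beta_reduce
      rw [(eK _).1 w hw, (eI _).1 w hw, (eS _).1 w hw, (eL _).1 w hw, (eD _).1 w hw,
        (eF _).1 w hw, (eK _).1 w hw]
    · simp only [(eK _).2.1 h, (eI _).2.1 h, (eS _).2.1 h, (eL _).2.1 h, (eD _).2.1 h,
        (eF _).2.1 h]
    · beta_reduce
      obtain ⟨k1, -, k2⟩ := eK x
      have p1 := (Pc k1).trans h
      replace k2 := k2 h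
      generalize K x = x1 at *
      obtain ⟨f1, -, f2⟩ := eF x1
      have p2 := (Pc f1).trans p1
      replace f2 := f2 p1
      generalize F x1 = x2 at *
      obtain ⟨d1, -, d2⟩ := eD x2
      have p3 := (Pc d1).trans p2
      replace d2 := d2 p2
      generalize D x2 = x3 at *
      obtain ⟨l1, -, l2⟩ := eL x3
      have p4 := (Pc l1).trans p3
      replace l2 := l2 p3
      generalize L x3 = x4 at *
      obtain ⟨s1, -, s2⟩ := eS x4
      have p5 := (Pc s1).trans p4
      replace s2 := s2 p4
      generalize S x4 = x5 at *
      obtain ⟨i1, -, i2⟩ := eI x5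
      have p6 := (Pc i1).trans p5
      replace i2 := i2 p5
      generalize I x5 = x6 at *
      obtain ⟨m1, -, m2⟩ := eK x6
      replace m2 := m2 p6
      generalize K x6 = x7 at *
      have la := readNat_lt A x r
      have lb := readNat_lt B x r
      simp only [readNat, pow_succ]
      exact lehmerStep_succ la lb k2 f2 d2 l2 s2 i2 m2

/-! ### The two digit widths: an additional leading qubit in the first register, or equal widths. -/

theorem card_digitWires_le (A : ℕ → W) (r : ℕ) : (digitWires A r).card ≤ r :=
  Finset.card_image_le.trans (by simp)

/-- The extra bit `h` matters in two cases only. If `h` is set, the first number is exactly `T`: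
swapping and decrementing put `T - 1` into the second register, `h` is cleared, and the final step
fixes that pair. If `h` is not set and `b = T - 1`, then `b + 1` overflows: `h` is set, and
incrementing and swapping leave `(T, a)`. Otherwise only the final step acts. -/
theorem lehmerStep_carry {T a b a1 b1 a2 b2 a3 b3 a4 b4 a5 b5 a6 b6 : ℕ}
    {h h1 h2 h3 h4 h5 h6 : Bool} (la : a < T) (lb : b < T) (hv : h = true → a = 0)
    (s : h1 = h ∧ (h = false → a1 = a ∧ b1 = b) ∧ (h = true → a1 = b ∧ b1 = a))
    (d : h2 = h1 ∧ a2 = a1 ∧ (h1 = false → b2 = b1) ∧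
      (h1 = true → (b1 = 0 → b2 + 1 = T) ∧ (b1 ≠ 0 → b2 + 1 = b1)))
    (n : a3 = a2 ∧ b3 = b2 ∧ (b2 + 1 = T → h3 = !h2) ∧ (b2 + 1 ≠ T → h3 = h2))
    (i : h4 = h3 ∧ a4 = a3 ∧ (h3 = false → b4 = b3) ∧
      (h3 = true → (b3 + 1 = T → b4 = 0) ∧ (b3 + 1 ≠ T → b4 = b3 + 1)))
    (s' : h5 = h4 ∧ (h4 = false → a5 = a4 ∧ b5 = b4) ∧ (h4 = true → a5 = b4 ∧ b5 = a4))
    (f : h6 = h5 ∧ (h5 = true → a6 = a5 ∧ b6 = b5) ∧ (h5 = false → LehmerStep T a5 b5 a6 b6)) :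
    (b < a + T * h.toNat → a6 + T * h6.toNat = b ∧ b6 + 1 = a + T * h.toNat) ∧
      (a + T * h.toNat ≤ b → a6 + T * h6.toNat = b + 1 ∧ b6 = a + T * h.toNat) := by
  obtain ⟨rfl, s1, s2⟩ := s
  obtain ⟨rfl, rfl, d1, d2⟩ := d
  obtain ⟨rfl, rfl, n1, n2⟩ := n
  obtain ⟨rfl, rfl, i1, i2⟩ := i
  obtain ⟨rfl, s3, s4⟩ := s'
  obtain ⟨rfl, f1, f2⟩ := f
  unfold LehmerStep at *
  cases h2 <;> cases h6 <;>
    simp only [Bool.toNat_true, Bool.toNat_false, ne_eq, reduceCtorEq, forall_const, Bool.not_true,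
      Bool.not_false, implies_true, IsEmpty.forall_iff, mul_zero, mul_one, add_zero] at * <;>
    grind

theorem exists_lehmerStep_carry {R : Set W} (A B : ℕ → W) (q : ℕ)
    (hAR : ∀ i < q + 1, A i ∈ R) (hBR : ∀ i < q, B i ∈ R)
    (hA : ∀ i < q + 1, ∀ j < q + 1, A i = A j → i = j)
    (hB : ∀ i < q, ∀ j < q, B i = B j → i = j) (hAB : ∀ i < q + 1, ∀ j < q, A i ≠ B j) :
    ∃ f : (W → Bool) → (W → Bool), Realizes R (9000 * (q + 1) ^ 4) (permMat f) ∧ ∀ x,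
      (∀ w ∉ digitWires A (q + 1) ∪ digitWires B q, f x w = x w) ∧
      (readNat A x (q + 1) ≤ 2 ^ q →
        (readNat B x q < readNat A x (q + 1) → readNat A (f x) (q + 1) = readNat B x q ∧
          readNat B (f x) q + 1 = readNat A x (q + 1)) ∧
        (readNat A x (q + 1) ≤ readNat B x q →
          readNat A (f x) (q + 1) = readNat B x q + 1 ∧
          readNat B (f x) q = readNat A x (q + 1))) := by
  set U' := digitWires A (q + 1) ∪ digitWires B q with hU'def
  set U := digitWires A q ∪ digitWires B q with hUdef
  set d := 156 * (2 * q + 1) ^ 2 with hd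
  have hAq := notMem_digitWires hA (Nat.lt_succ_self q)
  have hUU : U ⊆ U' := Finset.union_subset_union_left (digitWires_mono A (Nat.le_succ q))
  have hAq' : A q ∈ U' := Finset.mem_union_left _ (self_mem_digitWires A (Nat.lt_succ_self q))
  have hAqB : A q ∉ digitWires B q := fun h => by
    obtain ⟨j, hj, e⟩ := mem_digitWires.1 h
    exact hAB q (by omega) j hj e.symm
  have hAqU : A q ∉ U := by
    rw [hUdef, Finset.mem_union, not_or]
    exact ⟨hAq, hAqB⟩
  have hA0 : ∀ i < q, ∀ j < q, A i = A j → i = j := fun i hi j hj => hA i (by omega) j (by omega)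
  have hAB0 : ∀ i < q, ∀ j < q, A i ≠ B j := fun i hi j hj => hAB i (by omega) j (by omega)
  have hBU : digitWires B q ⊆ U := Finset.subset_union_right
  have hAU : digitWires A q ⊆ U := Finset.subset_union_left
  have hcard : U'.card ≤ 2 * q + 1 := by
    refine (Finset.card_union_le _ _).trans ?_
    have h1 := card_digitWires_le A (q + 1)
    have h2 := card_digitWires_le B q
    omega
  have hP : IsControl R U' d fun _ => true := by
    refine (isControl_true (U := U') fun w hw => ?_).mono subset_rfl
      (Nat.mul_le_mul_left _ (Nat.pow_le_pow_left hcard 2))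
    rcases Finset.mem_union.1 hw with h | h
    · obtain ⟨j, hj, rfl⟩ := mem_digitWires.1 h
      exact hAR j hj
    · obtain ⟨j, hj, rfl⟩ := mem_digitWires.1 h
      exact hBR j hj
  have hPb : ∀ b : Bool, IsControl R U d fun x => x (A q) == b := by
    intro b
    have := hP.and_cube (T := {A q}) (U' := U) (by simpa using hAq') hUU (by simpa using hAqU)
      fun _ => b
    refine Eq.subst (motive := fun P => IsControl R U d P) (funext fun x => ?_) this
    rw [Bool.eq_iff_iff]
    simp [cube]
  obtain ⟨L, hL, hLx⟩ := exists_condSwap (hPb true) A B q subset_rfl hA0 hB hAB0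
  obtain ⟨D, hD, hDx⟩ := exists_condDec (hPb true) B q hBU hB
  obtain ⟨I, hI, hIx⟩ := exists_condInc (hPb true) B q hBU hB
  obtain ⟨F, hF, hFx⟩ := exists_lehmerStep A B q (hPb false) (fun i hi => hAR i (by omega)) hBR
    hA0 hB hAB0
  have hN := hP.realizes (A q) hAq' (digitWires B q) (hBU.trans hUU) hAqB fun _ => true
  set N := condNot (A q) fun x => true && cube (digitWires B q) (fun _ => true) x with hNdef
  have rA : ∀ {x y : W → Bool}, (∀ w ∉ digitWires B q, w ≠ A q → y w = x w) →
      readNat A y q = readNat A x q := fun h => readNat_congr fun j hj =>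
    h _ (fun h' => by
      obtain ⟨i, hi, e⟩ := mem_digitWires.1 h'
      exact hAB0 j hj i hi e.symm)
      (fun e => by have := hA _ (by omega) _ (by omega) e; omega)
  have rB : ∀ {x y : W → Bool}, (∀ w, w ≠ A q → y w = x w) →
      readNat B y q = readNat B x q := fun h => readNat_congr fun j hj =>
    h _ (hAB q (by omega) j (by omega)).symm
  have eL : ∀ x, L x (A q) = x (A q) ∧ (x (A q) = false →
      readNat A (L x) q = readNat A x q ∧ readNat B (L x) q = readNat B x q) ∧
      (x (A q) = true →
        readNat A (L x) q = readNat B x q ∧ readNat B (L x) q = readNat A x q) := by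
    intro x
    obtain ⟨h1, h2, h3⟩ := hLx x
    exact ⟨h1 _ hAqU, fun h => by simp [h2 (by simp [h])],
      fun h => ⟨readNat_congr fun j hj => (h3 (by simp [h]) j hj).1,
        readNat_congr fun j hj => (h3 (by simp [h]) j hj).2⟩⟩
  have eD : ∀ x, D x (A q) = x (A q) ∧ readNat A (D x) q = readNat A x q ∧ (x (A q) = false →
      readNat B (D x) q = readNat B x q) ∧ (x (A q) = true →
        (readNat B x q = 0 → readNat B (D x) q + 1 = 2 ^ q) ∧
        (readNat B x q ≠ 0 → readNat B (D x) q + 1 = readNat B x q)) := by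
    intro x
    obtain ⟨h1, h2, h3⟩ := hDx x
    exact ⟨h1 _ hAqB, rA fun w hw _ => h1 w hw, fun h => by rw [h2 (by simp [h])],
      fun h => h3 (by simp [h])⟩
  have eI : ∀ x, I x (A q) = x (A q) ∧ readNat A (I x) q = readNat A x q ∧ (x (A q) = false →
      readNat B (I x) q = readNat B x q) ∧ (x (A q) = true →
        (readNat B x q + 1 = 2 ^ q → readNat B (I x) q = 0) ∧
        (readNat B x q + 1 ≠ 2 ^ q → readNat B (I x) q = readNat B x q + 1)) := by
    intro x
    obtain ⟨h1, h2, h3⟩ := hIx x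
    exact ⟨h1 _ hAqB, rA fun w hw _ => h1 w hw, fun h => by rw [h2 (by simp [h])],
      fun h => h3 (by simp [h])⟩
  have eN : ∀ x, readNat A (N x) q = readNat A x q ∧ readNat B (N x) q = readNat B x q ∧
      (readNat B x q + 1 = 2 ^ q → N x (A q) = !x (A q)) ∧
      (readNat B x q + 1 ≠ 2 ^ q → N x (A q) = x (A q)) := by
    intro x
    refine ⟨rA fun w _ h => condNot_of_ne _ _ h, rB fun w h => condNot_of_ne _ _ h,
      fun h => ?_, fun h => ?_⟩
    · rw [hNdef, condNot_self, cube_digitWires_true.2 h]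
      simp
    · rw [hNdef, condNot_self, Bool.eq_false_iff.2 (mt cube_digitWires_true.1 h)]
      simp
  have eF : ∀ x, F x (A q) = x (A q) ∧ (x (A q) = true →
      readNat A (F x) q = readNat A x q ∧ readNat B (F x) q = readNat B x q) ∧
      (x (A q) = false → LehmerStep (2 ^ q) (readNat A x q) (readNat B x q)
          (readNat A (F x) q) (readNat B (F x) q)) := by
    intro x
    obtain ⟨h1, h2, h3⟩ := hFx x
    exact ⟨h1 _ hAqU, fun h => by simp [h2 (by simp [h])], fun h => h3 (by simp [h])⟩
  refine ⟨fun x => F (L (I (N (D (L x))))), ?_, fun x => ⟨fun w hw => ?_, fun hx => ?_⟩⟩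
  · refine (hF.comp (hL.comp (hI.comp (hN.comp (hD.comp hL))))).mono ?_
    rw [hd]
    ring_nf
    nlinarith [Nat.zero_le (q ^ 4), Nat.zero_le (q ^ 3), Nat.zero_le (q ^ 2), Nat.zero_le q]
  · have hwU : w ∉ U := fun h => hw (hUU h)
    have hwB : w ∉ digitWires B q := fun h => hwU (hBU h)
    have hN' : ∀ x, N x w = x w := fun x => condNot_of_ne _ _ (by rintro rfl; exact hw hAq')
    beta_reduce
    rw [(hFx _).1 w hwU, (hLx _).1 w hwU, (hIx _).1 w hwB, hN', (hDx _).1 w hwB, (hLx _).1 w hwU]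
  · simp only [readNat] at hx ⊢
    refine lehmerStep_carry (readNat_lt A x q) (readNat_lt B x q) (fun h => ?_)
      (eL x) (eD _) (eN _) (eI _) (eL _) (eF _)
    rw [h] at hx
    simpa using hx

theorem exists_lehmerStep_equal {R : Set W} (A B : ℕ → W) (q : ℕ)
    (hAR : ∀ i < q, A i ∈ R) (hBR : ∀ i < q, B i ∈ R)
    (hA : ∀ i < q, ∀ j < q, A i = A j → i = j)
    (hB : ∀ i < q, ∀ j < q, B i = B j → i = j) (hAB : ∀ i < q, ∀ j < q, A i ≠ B j) :
    ∃ f : (W → Bool) → (W → Bool), Realizes R (9000 * (q + 1) ^ 4) (permMat f) ∧ ∀ x,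
      (∀ w ∉ digitWires A q ∪ digitWires B q, f x w = x w) ∧
      LehmerStep (2 ^ q) (readNat A x q) (readNat B x q)
          (readNat A (f x) q) (readNat B (f x) q) := by
  have hcard : (digitWires A q ∪ digitWires B q).card ≤ 2 * q := by
    refine (Finset.card_union_le _ _).trans ?_
    have h1 := card_digitWires_le A q
    have h2 := card_digitWires_le B q
    omega
  have hP : IsControl R (digitWires A q ∪ digitWires B q) (156 * (2 * q) ^ 2) fun _ => true := by
    refine (isControl_true fun w hw => ?_).mono subset_rfl
      (Nat.mul_le_mul_left _ (Nat.pow_le_pow_left hcard 2))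
    rcases Finset.mem_union.1 hw with h | h
    · obtain ⟨j, hj, rfl⟩ := mem_digitWires.1 h
      exact hAR j hj
    · obtain ⟨j, hj, rfl⟩ := mem_digitWires.1 h
      exact hBR j hj
  obtain ⟨F, hF, hFx⟩ := exists_lehmerStep A B q hP hAR hBR hA hB hAB
  refine ⟨F, hF.mono ?_, fun x => ⟨(hFx x).1, (hFx x).2.2 rfl⟩⟩
  ring_nf
  nlinarith [Nat.zero_le (q ^ 4), Nat.zero_le (q ^ 3), Nat.zero_le (q ^ 2), Nat.zero_le q]

/-! Lehmer codes. -/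

/-- Exactly `σ i` values lie below `σ i`; they are sorted by whether they occur after or before the
position `i`. -/
theorem lehmer_add_card {n : ℕ} (σ : Equiv.Perm (Fin n)) (i : Fin n) :
    lehmer σ i + (Finset.univ.filter fun j : Fin n => j < i ∧ σ j < σ i).card = σ i := by
  have h : (Finset.univ.filter fun j : Fin n => σ j < σ i).card = σ i := by
    rw [← Fin.card_Iio (σ i), ← Finset.card_map σ.toEmbedding]
    congr 1
    ext j
    simp [Finset.mem_map_equiv]
  rw [lehmer, ← h, ← Finset.card_union_of_disjoint]
  · congr 1
    ext j
    simp only [Finset.mem_union, Finset.mem_filter, Finset.mem_univ, true_and]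
    constructor
    · rintro (h | h)
      exacts [h.2, h.2]
    · intro h
      rcases lt_trichotomy i j with h' | rfl | h'
      · exact Or.inl ⟨h', h⟩
      · exact absurd h (lt_irrefl _)
      · exact Or.inr ⟨h', h⟩
  · rw [Finset.disjoint_filter]
    intro j _ h1 h2
    exact absurd (h1.1.trans h2.1) (lt_irrefl _)

theorem lehmer_le {n : ℕ} (σ : Equiv.Perm (Fin n)) (i : Fin n) : lehmer σ i ≤ n - 1 - i := by
  rw [← Fin.card_Ioi i, lehmer]
  refine Finset.card_le_card fun j hj => ?_
  simp only [Finset.mem_filter, Finset.mem_univ, true_and] at hj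
  exact Finset.mem_Ioi.2 hj.1

theorem lehmer_lt {n : ℕ} (σ : Equiv.Perm (Fin n)) (i : Fin n) :
    lehmer σ i < 2 ^ Nat.clog 2 (n - (i : ℕ)) := by
  refine lt_of_lt_of_le ?_ (Nat.le_pow_clog (by norm_num) _)
  have := lehmer_le σ i
  omega

theorem lehmer_eq_max_iff {n : ℕ} (σ : Equiv.Perm (Fin n)) (i : Fin n) :
    lehmer σ i = n - 1 - i ↔ ∀ j, i < j → σ j < σ i := by
  have hsub : (Finset.univ.filter fun j : Fin n => i < j ∧ σ j < σ i) ⊆ Finset.Ioi i := by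
    intro j hj
    simp only [Finset.mem_filter, Finset.mem_univ, true_and] at hj
    exact Finset.mem_Ioi.2 hj.1
  rw [← Fin.card_Ioi i, lehmer]
  constructor
  · intro h j hj
    have := Finset.eq_of_subset_of_card_le hsub h.ge
    have hj' := Finset.mem_Ioi.2 hj
    rw [← this] at hj'
    exact (Finset.mem_filter.1 hj').2.2
  · intro h
    congr 1
    refine Finset.Subset.antisymm hsub fun j hj => ?_
    have hj' := Finset.mem_Ioi.1 hj
    simpa using ⟨hj', h j hj'⟩

theorem lehmer_congr_of_eq {n k : ℕ} {σ ρ : Equiv.Perm (Fin n)}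
    (h : ∀ p : Fin n, (p : ℕ) < k → σ p = ρ p) (p : Fin n) (hp : (p : ℕ) < k) :
    lehmer σ p = lehmer ρ p := by
  have h1 := lehmer_add_card σ p
  have h2 := lehmer_add_card ρ p
  rw [h p hp] at h1
  have e : (Finset.univ.filter fun j : Fin n => j < p ∧ σ j < ρ p) =
      Finset.univ.filter fun j : Fin n => j < p ∧ ρ j < ρ p := by
    ext j
    simp only [Finset.mem_filter, Finset.mem_univ, true_and]
    refine and_congr_right fun hj => ?_
    rw [h j (lt_trans hj hp)]
  rw [e] at h1
  omega

/-- A value is determined by its Lehmer digit and the values before it. -/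
theorem lehmer_lt_of_lt {n : ℕ} {σ ρ : Equiv.Perm (Fin n)} {p : Fin n}
    (h : ∀ j < p, σ j = ρ j) (hlt : σ p < ρ p) : lehmer σ p < lehmer ρ p := by
  have h1 := lehmer_add_card σ p
  have h2 := lehmer_add_card ρ p
  -- Raising the value at `p` from `σ p` to `ρ p` brings in only earlier values strictly between the
  -- two. There are fewer than `ρ p - σ p` of these, so the digit must grow.
  have key : (Finset.univ.filter fun j : Fin n => j < p ∧ ρ j < ρ p).card <
      (Finset.univ.filter fun j : Fin n => j < p ∧ σ j < σ p).card + ((ρ p : ℕ) - σ p) := by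
    have hc : (Finset.univ.filter fun j : Fin n => j < p ∧ ρ j < ρ p).card ≤
        (Finset.univ.filter fun j : Fin n => j < p ∧ σ j < σ p).card +
          (Finset.Ioo (σ p) (ρ p)).card := by
      rw [← Finset.card_map (s := Finset.Ioo (σ p) (ρ p)) σ.symm.toEmbedding]
      refine (Finset.card_le_card fun j hj => ?_).trans (Finset.card_union_le _ _)
      simp only [Finset.mem_filter, Finset.mem_univ, true_and, Finset.mem_union] at hj ⊢
      rcases lt_trichotomy (σ j) (σ p) with h' | h' | h'
      · exact Or.inl ⟨hj.1, h'⟩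
      · exact absurd (σ.injective h') hj.1.ne
      · refine Or.inr (Finset.mem_map.2 ⟨σ j, ?_, by simp⟩)
        rw [Finset.mem_Ioo]
        exact ⟨h', by rw [h j hj.1]; exact hj.2⟩
    rw [Fin.card_Ioo] at hc
    have : (σ p : ℕ) < ρ p := hlt
    omega
  have : (σ p : ℕ) < ρ p := hlt
  omega

theorem eq_of_lehmer_eq {n k : ℕ} {σ ρ : Equiv.Perm (Fin n)}
    (h : ∀ p : Fin n, (p : ℕ) < k → lehmer σ p = lehmer ρ p) :
    ∀ p : Fin n, (p : ℕ) < k → σ p = ρ p := by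
  intro p
  induction p using WellFoundedLT.induction with
  | ind p ih =>
    intro hp
    have hlt : ∀ j < p, σ j = ρ j := fun j hj => ih j hj (lt_trans hj hp)
    rcases lt_trichotomy (σ p) (ρ p) with h' | h' | h'
    · exact absurd (h p hp) (lehmer_lt_of_lt hlt h').ne
    · exact h'
    · exact absurd (h p hp) (lehmer_lt_of_lt (fun j hj => (hlt j hj).symm) h').ne'

theorem lehmerBits_eq_iff {n : ℕ} {σ : Equiv.Perm (Fin n)} {i : Fin n} {m : ℕ}
    (hm : m < 2 ^ Nat.clog 2 (n - (i : ℕ))) :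
    (∀ j, lehmerBits σ ⟨i, j⟩ = m.testBit j) ↔ lehmer σ i = m := by
  constructor
  · intro h
    refine Nat.eq_of_testBit_eq fun j => ?_
    by_cases hj : j < Nat.clog 2 (n - (i : ℕ))
    · exact h ⟨j, hj⟩
    · have hp : 2 ^ Nat.clog 2 (n - (i : ℕ)) ≤ 2 ^ j :=
        Nat.pow_le_pow_right (by norm_num) (not_lt.1 hj)
      rw [Nat.testBit_lt_two_pow ((lehmer_lt σ i).trans_le hp),
        Nat.testBit_lt_two_pow (hm.trans_le hp)]
  · rintro rfl j
    rfl

/-! The effect of an adjacent transposition on the Lehmer code. -/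

theorem lehmer_mul_adjSwap_of_ne {n : ℕ} (σ : Equiv.Perm (Fin n)) (s : Fin (n - 1)) {i : Fin n}
    (h1 : (i : ℕ) ≠ s) (h2 : (i : ℕ) ≠ s + 1) : lehmer (σ * adjSwap s) i = lehmer σ i := by
  have hs : (s : ℕ) < n - 1 := s.2
  have hi : adjSwap s i = i := Equiv.swap_apply_of_ne_of_ne
    (fun h => h1 (by rw [h])) (fun h => h2 (by rw [h]))
  rw [lehmer, lehmer, ← Finset.card_map (adjSwap s).toEmbedding]
  congr 1
  ext j
  have hinv : (adjSwap s)⁻¹ = adjSwap s := Equiv.swap_inv _ _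
  have hlt : i < adjSwap s j ↔ i < j := by
    rw [adjSwap, Equiv.swap_apply_def]
    split_ifs with ha hb
    · subst ha; rw [Fin.lt_def, Fin.lt_def]; simp only; omega
    · subst hb; rw [Fin.lt_def, Fin.lt_def]; simp only; omega
    · rfl
  have hmem : ∀ S : Finset (Fin n), j ∈ S.map (adjSwap s).toEmbedding ↔ adjSwap s j ∈ S := by
    intro S
    rw [Finset.mem_map_equiv, ← Equiv.Perm.inv_def, hinv]
  have hjj : adjSwap s (adjSwap s j) = j := by
    rw [← Equiv.Perm.mul_apply, adjSwap, Equiv.swap_mul_self, Equiv.Perm.one_apply]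
  rw [hmem]
  simp [hi, hlt, hjj]

/-- Let `c v` count the entries beyond position `i'` that are below `v`. The transposition does not
affect `c`; the later digit is `c` of its entry, and the earlier one is the same plus 1 if the two
entries form an inversion. As `c` is monotone, the order of the two entries can be read off from the
digits. -/
theorem lehmer_mul_adjSwap {n : ℕ} (σ : Equiv.Perm (Fin n)) (s : Fin (n - 1))
    {i i' : Fin n} (hi : (i : ℕ) = s) (hi' : (i' : ℕ) = s + 1) :
    (lehmer σ i' < lehmer σ i → lehmer (σ * adjSwap s) i = lehmer σ i' ∧
      lehmer (σ * adjSwap s) i' + 1 = lehmer σ i) ∧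
    (lehmer σ i ≤ lehmer σ i' → lehmer (σ * adjSwap s) i = lehmer σ i' + 1 ∧
      lehmer (σ * adjSwap s) i' = lehmer σ i) := by
  have hlt : i < i' := by rw [Fin.lt_def]; omega
  have hsw : adjSwap s = Equiv.swap i i' := by
    rw [adjSwap]
    congr 1 <;> ext <;> simp [hi, hi']
  have hswi : adjSwap s i = i' := by rw [hsw, Equiv.swap_apply_left]
  have hswi' : adjSwap s i' = i := by rw [hsw, Equiv.swap_apply_right]
  have hswj : ∀ j, i' < j → adjSwap s j = j := fun j hj => by
    rw [hsw]
    exact Equiv.swap_apply_of_ne_of_ne (hlt.trans hj).ne' hj.ne'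
  have hor : ∀ j, i < j ↔ j = i' ∨ i' < j := fun j => by
    rw [Fin.lt_def, Fin.lt_def, Fin.ext_iff]
    omega
  -- the number of entries after `i'` that are below `v`
  let c : Fin n → ℕ := fun v => (Finset.univ.filter fun j : Fin n => i' < j ∧ σ j < v).card
  have hc : ∀ {u v}, u ≤ v → c u ≤ c v := fun {u v} h => Finset.card_le_card fun j hj => by
    simp only [Finset.mem_filter, Finset.mem_univ, true_and] at hj ⊢
    exact ⟨hj.1, hj.2.trans_le h⟩
  have key : ∀ ρ : Equiv.Perm (Fin n), (∀ j, i' < j → ρ j = σ j) →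
      lehmer ρ i' = c (ρ i') ∧ lehmer ρ i = c (ρ i) + if ρ i' < ρ i then 1 else 0 := by
    intro ρ hρ
    constructor
    · refine congrArg Finset.card (Finset.filter_congr fun j _ => ?_)
      refine and_congr_right fun hj => ?_
      rw [hρ j hj]
    · have e : (Finset.univ.filter fun j : Fin n => i < j ∧ ρ j < ρ i) =
          (Finset.univ.filter fun j : Fin n => i' < j ∧ σ j < ρ i) ∪
            if ρ i' < ρ i then {i'} else ∅ := by
        ext j
        have h1 : i' < j → ρ j = σ j := hρ j
        simp only [Finset.mem_union, Finset.mem_filter, Finset.mem_univ, true_and, hor]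
        split_ifs with h
        · rw [Finset.mem_singleton]
          constructor
          · rintro ⟨rfl | h2, h3⟩
            · exact Or.inr rfl
            · exact Or.inl ⟨h2, by rwa [← h1 h2]⟩
          · rintro (⟨h2, h3⟩ | rfl)
            · exact ⟨Or.inr h2, by rwa [h1 h2]⟩
            · exact ⟨Or.inl rfl, h⟩
        · constructor
          · rintro ⟨rfl | h2, h3⟩
            · exact absurd h3 h
            · exact Or.inl ⟨h2, by rwa [← h1 h2]⟩
          · rintro (⟨h2, h3⟩ | h2)
            · exact ⟨Or.inr h2, by rwa [h1 h2]⟩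
            · simp at h2
      rw [lehmer, e, Finset.card_union_of_disjoint]
      · congr 1
        split_ifs <;> simp
      · split_ifs <;> simp
  obtain ⟨h1, h2⟩ := key σ fun _ _ => rfl
  obtain ⟨h3, h4⟩ := key (σ * adjSwap s) fun j hj => by rw [Equiv.Perm.mul_apply, hswj j hj]
  rw [Equiv.Perm.mul_apply, hswi'] at h3
  rw [Equiv.Perm.mul_apply, Equiv.Perm.mul_apply, hswi, hswi'] at h4
  have hne : σ i ≠ σ i' := fun h => hlt.ne (σ.injective h)
  rcases lt_or_gt_of_ne hne with h | h
  · have := hc h.le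
    rw [if_neg (not_lt.2 h.le)] at h2
    rw [if_pos h] at h4
    omega
  · have := hc (le_of_lt h)
    rw [if_pos h] at h2
    rw [if_neg (not_lt.2 (le_of_lt h))] at h4
    omega

/-! Words of adjacent transpositions. -/

theorem adjSwap_val {n : ℕ} (s : Fin (n - 1)) (p : Fin n) :
    (adjSwap s p : ℕ) = if (p : ℕ) = s then (s : ℕ) + 1 else if (p : ℕ) = s + 1 then s else p := by
  rw [adjSwap, Equiv.swap_apply_def]
  simp only [Fin.ext_iff]
  split_ifs <;> rfl

theorem wordPerm_cons {n : ℕ} (s : Fin (n - 1)) (w : List (Fin (n - 1))) :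
    wordPerm (s :: w) = adjSwap s * wordPerm w := by simp [wordPerm]

theorem wordPerm_singleton {n : ℕ} (s : Fin (n - 1)) : wordPerm [s] = adjSwap s := by
  simp [wordPerm]

theorem wordPerm_append {n : ℕ} (v w : List (Fin (n - 1))) :
    wordPerm (v ++ w) = wordPerm v * wordPerm w := by simp [wordPerm]

theorem wordPerm_descending_val {n : ℕ} (m : ℕ) (hm : m ≤ n - 1) (p : Fin n) :
    (wordPerm ((List.ofFn fun s : Fin m => (⟨s, by omega⟩ : Fin (n - 1))).reverse) p : ℕ) =
      if (p : ℕ) = 0 then m else if (p : ℕ) ≤ m then (p : ℕ) - 1 else p := by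
  induction m with
  | zero =>
    simp only [List.ofFn_zero, List.reverse_nil, wordPerm, List.map_nil, List.prod_nil,
      Equiv.Perm.one_apply]
    split_ifs <;> omega
  | succ m ih =>
    rw [List.ofFn_succ', List.concat_eq_append, List.reverse_append, List.reverse_singleton,
      List.singleton_append, wordPerm_cons, Equiv.Perm.mul_apply, adjSwap_val]
    have := ih (by omega)
    simp only [Fin.val_castSucc, Fin.val_last] at this ⊢
    rw [this]
    split_ifs <;> omega

theorem wordPerm_frontWord_val {n : ℕ} (t p : Fin n) :
    (wordPerm (frontWord t) p : ℕ) =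
      if (p : ℕ) = 0 then (t : ℕ) else if (p : ℕ) ≤ t then (p : ℕ) - 1 else p :=
  wordPerm_descending_val t (by omega) p

theorem wordPerm_ascending_val {n : ℕ} (t m : ℕ) (hm : t + m ≤ n - 1) (p : Fin n) :
    (wordPerm (List.ofFn fun s : Fin m => (⟨t + s, by omega⟩ : Fin (n - 1))) p : ℕ) =
      if (p : ℕ) = t + m then t else if t ≤ (p : ℕ) ∧ (p : ℕ) < t + m then (p : ℕ) + 1 else p := by
  induction m generalizing p with
  | zero =>
    simp only [List.ofFn_zero, wordPerm, List.map_nil, List.prod_nil, Equiv.Perm.one_apply]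
    split_ifs <;> omega
  | succ m ih =>
    rw [List.ofFn_succ', List.concat_eq_append, wordPerm_append, Equiv.Perm.mul_apply]
    have h1 := ih (by omega) (adjSwap ⟨t + m, by omega⟩ p)
    have h2 := adjSwap_val (n := n) ⟨t + m, by omega⟩ p
    rw [wordPerm_singleton]
    simp only [Fin.val_castSucc, Fin.val_last] at h1 h2 ⊢
    rw [h1, h2]
    split_ifs <;> omega

theorem wordPerm_backWord_val {n : ℕ} (t p : Fin n) :
    (wordPerm (backWord t) p : ℕ) =
      if (p : ℕ) = n - 1 then (t : ℕ) else if t ≤ p then (p : ℕ) + 1 else p := by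
  have h := wordPerm_ascending_val (n := n) t (n - 1 - t) (by omega) p
  rw [backWord, h]
  simp only [Fin.le_def]
  split_ifs <;> omega

/-- Each new cycle fetches the next index to the first position and pushes the indices already
placed one position to the right, hence the reversed order. -/
theorem exists_front {n : ℕ} (k : ℕ) (i : Fin k ↪ Fin n) :
    ∃ ts : List (Fin n), ts.length = k ∧ ∀ (l : Fin k) (p : Fin n), (p : ℕ) = k - 1 - (l : ℕ) →
      wordPerm (ts.flatMap frontWord) p = i l := by
  induction k with
  | zero => exact ⟨[], rfl, fun l => l.elim0⟩
  | succ k ih =>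
    obtain ⟨ts, hlen, hts⟩ := ih (Fin.castSuccEmb.trans i)
    set π := wordPerm (ts.flatMap frontWord) with hπ
    set t := π⁻¹ (i (Fin.last k)) with ht
    have hπt : π t = i (Fin.last k) := by simp [ht]
    -- The first `k` positions hold the indices already placed, so the new index lies beyond them
    -- and the cycle shifts all of them.
    have hkt : k ≤ (t : ℕ) := by
      by_contra hlt
      have h := hts ⟨k - 1 - t, by omega⟩ t (by simp only; omega)
      rw [hπt] at h
      have := congrArg Fin.val (i.injective h)
      simp at this
      omega
    refine ⟨ts ++ [t], by simp [hlen], fun l p hp => ?_⟩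
    rw [List.flatMap_append, wordPerm_append, Equiv.Perm.mul_apply, List.flatMap_singleton, ← hπ]
    have hv := wordPerm_frontWord_val t p
    induction l using Fin.lastCases with
    | last =>
      rw [← hπt]
      congr 1
      rw [Fin.ext_iff, hv, if_pos (by simp at hp; omega)]
    | cast l =>
      refine hts l _ ?_
      have := l.2
      rw [Fin.val_castSucc] at hp
      rw [hv, if_neg (by omega), if_pos (by omega)]
      omega

theorem exists_back {n : ℕ} (k : ℕ) (i : Fin k ↪ Fin n) :
    ∃ ts : List (Fin n), ts.length = k ∧ ∀ (l : Fin k) (p : Fin n), (p : ℕ) + k = n + l →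
      wordPerm (ts.flatMap backWord) p = i l := by
  induction k with
  | zero => exact ⟨[], rfl, fun l => l.elim0⟩
  | succ k ih =>
    obtain ⟨ts, hlen, hts⟩ := ih (Fin.castSuccEmb.trans i)
    set π := wordPerm (ts.flatMap backWord) with hπ
    set t := π⁻¹ (i (Fin.last k)) with ht
    have hπt : π t = i (Fin.last k) := by simp [ht]
    -- Likewise the last `k` positions are taken, so the cycle moves all of them one place to the
    -- left.
    have hkt : (t : ℕ) + k < n := by
      by_contra hlt
      have h := hts ⟨t + k - n, by omega⟩ t (by simp only; omega)
      rw [hπt] at h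
      have := congrArg Fin.val (i.injective h)
      simp at this
      omega
    refine ⟨ts ++ [t], by simp [hlen], fun l p hp => ?_⟩
    rw [List.flatMap_append, wordPerm_append, Equiv.Perm.mul_apply, List.flatMap_singleton, ← hπ]
    have hv := wordPerm_backWord_val t p
    induction l using Fin.lastCases with
    | last =>
      rw [← hπt]
      congr 1
      rw [Fin.ext_iff, hv, if_pos (by simp at hp; omega)]
    | cast l =>
      refine hts l _ ?_
      have := l.2
      rw [Fin.val_castSucc] at hp
      rw [hv, if_neg (by omega), if_pos (by rw [Fin.le_def]; omega)]
      omega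

theorem length_flatMap_le {α β : Type*} (f : α → List β) {n : ℕ} (hf : ∀ a, (f a).length ≤ n)
    (l : List α) : (l.flatMap f).length ≤ l.length * n := by
  induction l with
  | nil => simp
  | cons a l ih =>
    rw [List.flatMap_cons, List.length_append, List.length_cons, add_mul, one_mul]
    have := hf a
    omega

theorem length_frontWord_le {n : ℕ} (t : Fin n) : (frontWord t).length ≤ n := by
  simp [frontWord]

theorem length_backWord_le {n : ℕ} (t : Fin n) : (backWord t).length ≤ n := by
  simp [backWord]
  omega

/-- Reordering multiplies on the right, so the first letter of the word is also the first circuit to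
be applied. -/
theorem wordCircuit_implementsReorder {n : ℕ} {V : Fin (n - 1) → Circuit (LehmerWire n)}
    (hV : ∀ s, ImplementsReorder (V s) (adjSwap s)) (w : List (Fin (n - 1))) :
    ImplementsReorder (wordCircuit V w) (wordPerm w) := by
  induction w with
  | nil =>
    intro σ
    simp [wordCircuit, wordPerm, Circuit.mat]
  | cons s w ih =>
    intro σ
    have e : Circuit.mat (wordCircuit V (s :: w)) =
        Circuit.mat (wordCircuit V w) * Circuit.mat (V s) := by
      simp [wordCircuit, Circuit.mat]
    rw [e, ← Matrix.mulVec_mulVec, hV s, ih, wordPerm_cons, mul_assoc]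

theorem depth_wordCircuit_le {n : ℕ} {V : Fin (n - 1) → Circuit (LehmerWire n)} {D : ℝ}
    (hV : ∀ s, (Circuit.depth (V s) : ℝ) ≤ D) (w : List (Fin (n - 1))) :
    (Circuit.depth (wordCircuit V w) : ℝ) ≤ w.length * D := by
  induction w with
  | nil => simp [wordCircuit, Circuit.depth]
  | cons s w ih =>
    have e : Circuit.depth (wordCircuit V (s :: w)) =
        Circuit.depth (V s) + Circuit.depth (wordCircuit V w) := by
      simp [wordCircuit, Circuit.depth]
    rw [e, List.length_cons]
    push_cast
    linarith [hV s]

/-! Circuits on the Lehmer register. -/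

/-- The qubits of the `i`-th digit, padded by `w₀`. -/
def digitWire {n : ℕ} (w₀ : LehmerWire n) (i : Fin n) (j : ℕ) : LehmerWire n :=
  if h : j < Nat.clog 2 (n - (i : ℕ)) then ⟨i, ⟨j, h⟩⟩ else w₀

theorem digitWire_of_lt {n : ℕ} (w₀ : LehmerWire n) {i : Fin n} {j : ℕ}
    (h : j < Nat.clog 2 (n - (i : ℕ))) : digitWire w₀ i j = ⟨i, ⟨j, h⟩⟩ := dif_pos h

theorem digitWire_fst {n : ℕ} (w₀ : LehmerWire n) {i : Fin n} {j : ℕ}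
    (h : j < Nat.clog 2 (n - (i : ℕ))) : (digitWire w₀ i j).1 = i := by
  rw [digitWire_of_lt w₀ h]

theorem digitWire_inj {n : ℕ} (w₀ : LehmerWire n) {i : Fin n} {j j' : ℕ}
    (h : j < Nat.clog 2 (n - (i : ℕ))) (h' : j' < Nat.clog 2 (n - (i : ℕ)))
    (e : digitWire w₀ i j = digitWire w₀ i j') : j = j' := by
  rw [digitWire_of_lt w₀ h, digitWire_of_lt w₀ h'] at e
  simpa using e

theorem readNat_lehmerBits {n : ℕ} (w₀ : LehmerWire n) (σ : Equiv.Perm (Fin n)) (i : Fin n) :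
    readNat (digitWire w₀ i) (lehmerBits σ) (Nat.clog 2 (n - (i : ℕ))) = lehmer σ i :=
  readNat_eq (lehmer_lt σ i) fun j hj => by rw [digitWire_of_lt w₀ hj, lehmerBits]

theorem eq_testBit_of_readNat {n : ℕ} {w₀ : LehmerWire n} {i : Fin n} {x : LehmerWire n → Bool}
    {m : ℕ} (h : readNat (digitWire w₀ i) x (Nat.clog 2 (n - (i : ℕ))) = m)
    (j : Fin (Nat.clog 2 (n - (i : ℕ)))) : x ⟨i, j⟩ = m.testBit j := by
  rw [← h, readNat_testBit j.2, digitWire_of_lt w₀ j.2]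

theorem clog_add_one_cases {m : ℕ} :
    Nat.clog 2 (m + 1) = Nat.clog 2 m ∨ Nat.clog 2 (m + 1) = Nat.clog 2 m + 1 := by
  have h1 : Nat.clog 2 m ≤ Nat.clog 2 (m + 1) := Nat.clog_mono_right 2 (Nat.le_succ m)
  have h2 : Nat.clog 2 (m + 1) ≤ Nat.clog 2 m + 1 := by
    apply Nat.clog_le_of_le_pow
    have := Nat.le_pow_clog (b := 2) (by norm_num) m
    have : 1 ≤ 2 ^ Nat.clog 2 m := Nat.one_le_two_pow
    rw [pow_succ]
    omega
  omega

/-- The two digits have `m + 1` and `m` possible values, so their widths are equal or differ by one,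
and in either case the out-of-range pairs of the bit-level map are never met. -/
theorem exists_adjSwap_circuit {n : ℕ} (s : Fin (n - 1)) :
    ∃ c : Circuit (LehmerWire n),
      c.ActsOn {w | (w.1 : ℕ) = (s : ℕ) ∨ (w.1 : ℕ) = (s : ℕ) + 1} ∧
      ImplementsReorder c (adjSwap s) ∧ c.depth ≤ 9000 * (Nat.clog 2 n + 1) ^ 4 := by
  have hs := s.2
  set i : Fin n := ⟨s, by omega⟩ with hi
  set i' : Fin n := ⟨s + 1, by omega⟩ with hi'
  have hii : i ≠ i' := fun h => by simp [hi, hi', Fin.ext_iff] at h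
  obtain ⟨m, hm⟩ : ∃ m, m = n - (i' : ℕ) := ⟨_, rfl⟩
  have hm1 : n - (i : ℕ) = m + 1 := by simp only [hm, hi, hi']; omega
  have hp0 : 0 < Nat.clog 2 (n - (i : ℕ)) := Nat.clog_pos (by norm_num) (by
    have : (i : ℕ) = s := rfl
    omega)
  -- The padding is never used below the width of a digit. It is taken from the digit `s`, which has
  -- at least two values and hence a qubit, whereas the last digit has none.
  set w₀ : LehmerWire n := ⟨i, ⟨0, hp0⟩⟩
  set A := digitWire w₀ i with hA
  set B := digitWire w₀ i' with hB
  obtain ⟨p, hp⟩ : ∃ p, p = Nat.clog 2 (n - (i : ℕ)) := ⟨_, rfl⟩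
  obtain ⟨q, hq⟩ : ∃ q, q = Nat.clog 2 (n - (i' : ℕ)) := ⟨_, rfl⟩
  have hpq : p = q ∨ p = q + 1 := by
    rw [hp, hq, hm1, ← hm]
    exact clog_add_one_cases
  have hqn : q ≤ Nat.clog 2 n := hq ▸ Nat.clog_mono_right 2 (Nat.sub_le _ _)
  set R : Set (LehmerWire n) := {w | (w.1 : ℕ) = (s : ℕ) ∨ (w.1 : ℕ) = (s : ℕ) + 1}
  have hAR : ∀ j < p, A j ∈ R := fun j hj => Or.inl (by
    rw [hA, digitWire_fst w₀ (hp ▸ hj)])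
  have hBR : ∀ j < q, B j ∈ R := fun j hj => Or.inr (by
    rw [hB, digitWire_fst w₀ (hq ▸ hj)])
  have hAi : ∀ j < p, ∀ j' < p, A j = A j' → j = j' :=
    fun j hj j' hj' => digitWire_inj w₀ (hp ▸ hj) (hp ▸ hj')
  have hBi : ∀ j < q, ∀ j' < q, B j = B j' → j = j' :=
    fun j hj j' hj' => digitWire_inj w₀ (hq ▸ hj) (hq ▸ hj')
  have hAB : ∀ j < p, ∀ j' < q, A j ≠ B j' := fun j hj j' hj' e => hii (by
    have := congrArg Sigma.fst e
    rwa [hA, hB, digitWire_fst w₀ (hp ▸ hj), digitWire_fst w₀ (hq ▸ hj')] at this)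
  obtain ⟨f, hf, hfx⟩ : ∃ f : (LehmerWire n → Bool) → (LehmerWire n → Bool),
      Realizes R (9000 * (q + 1) ^ 4) (permMat f) ∧ ∀ x,
      (∀ w ∉ digitWires A p ∪ digitWires B q, f x w = x w) ∧
      (readNat A x p ≤ m → readNat B x q < m →
        (readNat B x q < readNat A x p →
          readNat A (f x) p = readNat B x q ∧ readNat B (f x) q + 1 = readNat A x p) ∧
        (readNat A x p ≤ readNat B x q →
          readNat A (f x) p = readNat B x q + 1 ∧ readNat B (f x) q = readNat A x p)) := by
    rcases hpq with h | h
    · rw [h] at hAR hAi hAB ⊢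
      obtain ⟨f, hf, hfx⟩ := exists_lehmerStep_equal A B q hAR hBR hAi hBi hAB
      refine ⟨f, hf, fun x => ⟨(hfx x).1, fun _ h2 => ?_⟩⟩
      -- The second digit is below `m`, and `m + 1 ≤ 2 ^ q` keeps it away from the pairs fixed
      -- artificially by `LehmerStep`.
      have hmq : m + 1 ≤ 2 ^ q := by
        rw [← h, hp, hm1]
        exact Nat.le_pow_clog (by norm_num) _
      have h3 := (hfx x).2
      exact ⟨h3.1, fun h4 => h3.2.1 h4 (by omega)⟩
    · rw [h] at hAR hAi hAB ⊢
      obtain ⟨f, hf, hfx⟩ := exists_lehmerStep_carry A B q hAR hBR hAi hBi hAB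
      refine ⟨f, hf, fun x => ⟨(hfx x).1, fun h1 _ => (hfx x).2 (h1.trans ?_)⟩⟩
      rw [hq, ← hm]
      exact Nat.le_pow_clog (by norm_num) _
  obtain ⟨c, h1, h2, h3⟩ := hf
  refine ⟨c, h1, fun σ => ?_, h2.trans (Nat.mul_le_mul_left _ (Nat.pow_le_pow_left
    (by omega) 4))⟩
  rw [h3, permMat_ket]
  congr 1
  obtain ⟨e1, e2⟩ := hfx (lehmerBits σ)
  have rA : readNat A (lehmerBits σ) p = lehmer σ i := by rw [hp]; exact readNat_lehmerBits w₀ σ i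
  have rB : readNat B (lehmerBits σ) q = lehmer σ i' := by
    rw [hq]; exact readNat_lehmerBits w₀ σ i'
  have b1 := lehmer_le σ i
  have b2 := lehmer_le σ i'
  rw [rA, rB] at e2
  have e3 := e2 (by omega) (by have := i'.2; omega)
  have e4 := lehmer_mul_adjSwap σ s (i := i) (i' := i') rfl rfl
  have e5 : readNat A (f (lehmerBits σ)) p = lehmer (σ * adjSwap s) i ∧
      readNat B (f (lehmerBits σ)) q = lehmer (σ * adjSwap s) i' := by
    rcases lt_or_ge (lehmer σ i') (lehmer σ i) with h | h
    · have := e3.1 h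
      have := e4.1 h
      omega
    · have := e3.2 h
      have := e4.2 h
      omega
  rw [hp, hq] at e5
  funext ⟨v, j⟩
  by_cases hv : v = i
  · subst hv
    exact eq_testBit_of_readNat e5.1 j
  · by_cases hv' : v = i'
    · subst hv'
      exact eq_testBit_of_readNat e5.2 j
    · rw [e1, lehmerBits, lehmerBits, lehmer_mul_adjSwap_of_ne]
      · exact fun h => hv (Fin.ext h)
      · exact fun h => hv' (Fin.ext h)
      · rw [Finset.mem_union, not_or, mem_digitWires, mem_digitWires]
        refine ⟨?_, ?_⟩
        · rintro ⟨j', hj', e⟩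
          have := congrArg Sigma.fst e
          rw [hA, digitWire_fst w₀ (hp ▸ hj')] at this
          exact hv this.symm
        · rintro ⟨j', hj', e⟩
          have := congrArg Sigma.fst e
          rw [hB, digitWire_fst w₀ (hq ▸ hj')] at this
          exact hv' this.symm

/-- Testing whether given digits of the Lehmer code have given bits. -/
theorem exists_digit_test {n : ℕ} (I : Finset (Fin n)) (v : LehmerWire n → Bool) :
    ∃ Q : Circuit (Option (LehmerWire n)),
      Q.ActsOn {o | ∀ w, o = some w → w.1 ∈ I} ∧
      Q.depth ≤ 156 * (I.card * Nat.clog 2 n + 1) ^ 2 ∧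
      ∀ (x : LehmerWire n → Bool) (b : Bool), (Circuit.mat Q).mulVec (ket (withOutput x b)) =
        ket (withOutput x (xor b (decide (∀ w, w.1 ∈ I → x w = v w)))) := by
  set S : Finset (LehmerWire n) := I.sigma fun _ => Finset.univ with hS
  have hmem : ∀ w, w ∈ S ↔ w.1 ∈ I := fun w => by simp [hS]
  have hcard : S.card ≤ I.card * Nat.clog 2 n := by
    rw [hS, Finset.card_sigma]
    refine Finset.sum_le_card_nsmul _ _ _ fun i _ => ?_
    rw [Finset.card_fin]
    exact Nat.clog_mono_right 2 (Nat.sub_le _ _)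
  obtain ⟨Q, h1, h2, h3⟩ := Realizes.condNot_cube (t := none)
    (R := {o : Option (LehmerWire n) | ∀ w, o = some w → w.1 ∈ I})
    (S := S.map Function.Embedding.some) (withOutput v true) (by
      intro o ho
      obtain ⟨w, hw, rfl⟩ := Finset.mem_map.1 ho
      rintro w' e
      rw [← Option.some_injective _ e]
      exact (hmem w).1 hw) (by simp) (by simp)
  refine ⟨Q, h1, h2.trans ?_, fun x b => ?_⟩
  · rw [Finset.card_map]
    exact Nat.mul_le_mul_left _ (Nat.pow_le_pow_left (by omega) 2)
  · rw [h3, permMat_ket]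
    congr 1
    have e : cube (S.map Function.Embedding.some) (withOutput v true) (withOutput x b) =
        decide (∀ w, w.1 ∈ I → x w = v w) := by
      rw [Bool.eq_iff_iff, cube_eq_true, decide_eq_true_iff]
      constructor
      · intro h w hw
        exact h (some w) (Finset.mem_map.2 ⟨w, (hmem w).2 hw, rfl⟩)
      · intro h o ho
        obtain ⟨w, hw, rfl⟩ := Finset.mem_map.1 ho
        exact h w ((hmem w).1 hw)
    funext o
    cases o with
    | none => rw [condNot_self, e]; rfl
    | some w => rw [condNot_of_ne _ _ (by simp)]; rfl

/-! ### Depth estimates. -/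

theorem clog_le_log {n : ℕ} (hn : 2 ≤ n) : (Nat.clog 2 n : ℝ) ≤ 4 * Real.log n := by
  have h1 : 2 ^ (Nat.clog 2 n - 1) < n := Nat.pow_pred_clog_lt_self (by norm_num) (by omega)
  have hpos : 0 < Nat.clog 2 n := Nat.clog_pos (by norm_num) hn
  have h2 : ((Nat.clog 2 n - 1 : ℕ) : ℝ) * Real.log 2 ≤ Real.log n := by
    rw [← Real.log_pow]
    exact Real.log_le_log (by positivity) (by exact_mod_cast h1.le)
  have h3 : Real.log 2 ≤ Real.log n := Real.log_le_log (by norm_num) (by exact_mod_cast hn)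
  have h4 := Real.log_two_gt_d9
  rw [Nat.cast_sub hpos, Nat.cast_one] at h2
  have h5 : (1 : ℝ) ≤ Nat.clog 2 n := by exact_mod_cast hpos
  -- From `(clog - 1) * log 2 ≤ log n` and `log 2 ≤ log n` follows `clog * log 2 ≤ 2 * log n`, and
  -- `log 2 > 1/2`.
  nlinarith

theorem cube_le_two_pow (m : ℕ) : m ^ 3 ≤ 4 * 2 ^ m := by
  rcases lt_or_ge m 4 with h | h
  · interval_cases m <;> norm_num
  · induction m, h using Nat.le_induction with
    | base => norm_num
    | succ m hm ih =>
      rw [pow_succ 2]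
      nlinarith [Nat.mul_le_mul_right (m ^ 2) hm, Nat.mul_le_mul_right m hm]

/-- The fourth power of the logarithm is far below the bound claimed: three of its factors are
absorbed by `n`, using `(clog 2 n) ^ 3 ≤ 8 * n`. The constant is 9000 · 128 · 4, rounded up. -/
theorem adjSwap_depth_bound {n : ℕ} (hn : 2 ≤ n) :
    ((9000 * (Nat.clog 2 n + 1) ^ 4 : ℕ) : ℝ) ≤ 5000000 * n * Real.log n := by
  have h1 : 2 ^ (Nat.clog 2 n - 1) < n := Nat.pow_pred_clog_lt_self (by norm_num) (by omega)
  have hpos : 0 < Nat.clog 2 n := Nat.clog_pos (by norm_num) hn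
  have h2 := clog_le_log hn
  have h3 := cube_le_two_pow (Nat.clog 2 n)
  obtain ⟨L, hL⟩ : ∃ L, Nat.clog 2 n = L + 1 := ⟨_, (Nat.succ_pred_eq_of_pos hpos).symm⟩
  rw [hL] at h1 h2 h3 ⊢
  rw [pow_succ 2] at h3
  simp only [Nat.add_sub_cancel] at h1
  have h4 : (L + 1) ^ 3 ≤ 8 * n := by omega
  have h5 : (L + 1 + 1) ^ 4 ≤ 128 * n * (L + 1) := by
    calc (L + 1 + 1) ^ 4 ≤ (2 * (L + 1)) ^ 4 := Nat.pow_le_pow_left (by omega) 4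
      _ = 16 * (L + 1) ^ 3 * (L + 1) := by ring
      _ ≤ 16 * (8 * n) * (L + 1) := by gcongr
      _ = 128 * n * (L + 1) := by ring
  have h6 : (((L + 1 + 1) ^ 4 : ℕ) : ℝ) ≤ 128 * n * ((L + 1 : ℕ) : ℝ) := by exact_mod_cast h5
  have h7 : (0 : ℝ) ≤ n := Nat.cast_nonneg n
  have h8 : (128 * n : ℝ) * ((L + 1 : ℕ) : ℝ) ≤ 128 * n * (4 * Real.log n) := by gcongr
  have h9 : 0 ≤ n * Real.log n := mul_nonneg h7 (Real.log_nonneg (by exact_mod_cast (by omega)))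
  rw [Nat.cast_mul]
  push_cast at h6 h8 ⊢
  nlinarith

theorem digit_test_depth_bound {n k c : ℕ} (hn : 2 ≤ n) (hk : 1 ≤ k) (hc : c ≤ 2 * k) :
    ((156 * (c * Nat.clog 2 n + 1) ^ 2 : ℕ) : ℝ) ≤ 5000000 * (k : ℝ) ^ 2 * Real.log n ^ 2 := by
  have hpos : 1 ≤ Nat.clog 2 n := Nat.clog_pos (by norm_num) hn
  have h1 : c * Nat.clog 2 n + 1 ≤ 3 * k * Nat.clog 2 n := by nlinarith
  have h2 := clog_le_log hn
  have h3 : ((c * Nat.clog 2 n + 1 : ℕ) : ℝ) ≤ 12 * k * Real.log n := by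
    calc ((c * Nat.clog 2 n + 1 : ℕ) : ℝ) ≤ ((3 * k * Nat.clog 2 n : ℕ) : ℝ) := by
          exact_mod_cast h1
      _ = 3 * k * (Nat.clog 2 n : ℝ) := by push_cast; ring
      _ ≤ 3 * k * (4 * Real.log n) := by gcongr
      _ = 12 * k * Real.log n := by ring
  calc ((156 * (c * Nat.clog 2 n + 1) ^ 2 : ℕ) : ℝ)
      = 156 * ((c * Nat.clog 2 n + 1 : ℕ) : ℝ) ^ 2 := by push_cast; ring
    _ ≤ 156 * (12 * k * Real.log n) ^ 2 := by gcongr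
    _ = 22464 * ((k : ℝ) ^ 2 * Real.log n ^ 2) := by ring
    _ ≤ 5000000 * ((k : ℝ) ^ 2 * Real.log n ^ 2) := by gcongr; norm_num
    _ = _ := by ring

/-- The first `k` digits determine, and are determined by, the first `k` values. -/
theorem partialAssignment_iff {n k : ℕ} {i : Fin k ↪ Fin n} {j : Fin k → Fin n}
    {π ρ : Equiv.Perm (Fin n)} (hk : k ≤ n)
    (hπ : ∀ (l : Fin k) (p : Fin n), (p : ℕ) = k - 1 - (l : ℕ) → π p = i l)
    (hρ : PartialAssignment i j ρ) (σ : Equiv.Perm (Fin n)) :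
    PartialAssignment i j σ ↔
      ∀ w : LehmerWire n, (w.1 : ℕ) < k → lehmerBits (σ * π) w = lehmerBits (ρ * π) w := by
  have h1 : PartialAssignment i j σ ↔ ∀ p : Fin n, (p : ℕ) < k → (σ * π) p = (ρ * π) p := by
    constructor
    · intro h p hp
      have e := hπ ⟨k - 1 - p, by omega⟩ p (by simp only; omega)
      rw [Equiv.Perm.mul_apply, Equiv.Perm.mul_apply, e, h, hρ]
    · intro h l
      have hl := l.2
      have e := hπ l ⟨k - 1 - l, by omega⟩ rfl
      have := h ⟨k - 1 - l, by omega⟩ (by simp only; omega)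
      rw [Equiv.Perm.mul_apply, Equiv.Perm.mul_apply, e, hρ] at this
      exact this
  rw [h1]
  constructor
  · rintro h ⟨p, b⟩ hp
    rw [lehmerBits, lehmerBits, lehmer_congr_of_eq h p hp]
  · intro h
    exact eq_of_lehmer_eq fun p hp =>
      (lehmerBits_eq_iff (lehmer_lt (ρ * π) p)).1 fun b => h ⟨p, b⟩ hp

/-- A ranking of the last entries says that the last digits are maximal. -/
theorem partialRanking_iff {n k : ℕ} {i : Fin (k + 1) ↪ Fin n} {π : Equiv.Perm (Fin n)}
    (hk : k + 1 ≤ n)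
    (hπ : ∀ (l : Fin (k + 1)) (p : Fin n), (p : ℕ) = n - 1 - k + (l : ℕ) → π p = i l)
    (σ : Equiv.Perm (Fin n)) :
    PartialRanking i σ ↔ ∀ w : LehmerWire n, n - 1 - k ≤ (w.1 : ℕ) →
      lehmerBits (σ * π) w = (n - 1 - (w.1 : ℕ)).testBit (w.2 : ℕ) := by
  have hanti : PartialRanking i σ ↔ StrictAnti fun l => σ (i l) :=
    (Fin.strictAnti_iff_succ_lt (f := fun l => σ (i l))).symm
  have hpos : ∀ p : Fin n, n - 1 - k ≤ (p : ℕ) → ∃ l : Fin (k + 1),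
      (p : ℕ) = n - 1 - k + (l : ℕ) := fun p hp =>
    ⟨⟨p - (n - 1 - k), by omega⟩, by simp only; omega⟩
  have h1 : PartialRanking i σ ↔ ∀ p : Fin n, n - 1 - k ≤ (p : ℕ) →
      lehmer (σ * π) p = n - 1 - p := by
    rw [hanti]
    constructor
    · intro h p hp
      rw [lehmer_eq_max_iff]
      intro p' hpp'
      obtain ⟨l, hl⟩ := hpos p hp
      obtain ⟨l', hl'⟩ := hpos p' (hp.trans (le_of_lt hpp'))
      rw [Equiv.Perm.mul_apply, Equiv.Perm.mul_apply, hπ l p hl, hπ l' p' hl']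
      refine h ?_
      rw [Fin.lt_def] at hpp' ⊢
      omega
    · intro h l l' hll'
      have hl := l'.2
      rw [Fin.lt_def] at hll'
      have := (lehmer_eq_max_iff (σ * π) ⟨n - 1 - k + l, by omega⟩).1
        (h _ (by simp only; omega)) ⟨n - 1 - k + l', by omega⟩ (by rw [Fin.lt_def]; simp only; omega)
      rwa [Equiv.Perm.mul_apply, Equiv.Perm.mul_apply, hπ l' _ rfl, hπ l _ rfl] at this
  rw [h1]
  have hmax : ∀ p : Fin n, n - 1 - (p : ℕ) < 2 ^ Nat.clog 2 (n - (p : ℕ)) := fun p =>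
    lt_of_lt_of_le (by omega) (Nat.le_pow_clog (by norm_num) _)
  constructor
  · rintro h ⟨p, b⟩ hp
    exact (lehmerBits_eq_iff (hmax p)).2 (h p hp) b
  · intro h p hp
    exact (lehmerBits_eq_iff (hmax p)).1 fun b => h ⟨p, b⟩ hp

theorem exists_partialAssignment_circuit {n k : ℕ} (hn : 2 ≤ n) (hk : 1 ≤ k) {i : Fin k ↪ Fin n}
    (j : Fin k → Fin n) {π : Equiv.Perm (Fin n)}
    (hπ : ∀ (l : Fin k) (p : Fin n), (p : ℕ) = k - 1 - (l : ℕ) → π p = i l) :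
    ∃ Q : Circuit (Option (LehmerWire n)),
      Q.ActsOn {o | ∀ v, o = some v → (v.1 : ℕ) < k} ∧
      ComputesAfterReorder Q π (PartialAssignment i j) ∧
      (Q.depth : ℝ) ≤ 5000000 * (k : ℝ) ^ 2 * Real.log n ^ 2 := by
  have hkn : k ≤ n := by simpa using Fintype.card_le_of_embedding i
  by_cases hex : ∃ ρ, PartialAssignment i j ρ
  · obtain ⟨ρ, hρ⟩ := hex
    set I : Finset (Fin n) := Finset.univ.filter fun p => (p : ℕ) < k with hI
    have hmem : ∀ p, p ∈ I ↔ (p : ℕ) < k := fun p => by simp [hI]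
    have hcard : I.card ≤ k := by
      have h : I.card ≤ (Finset.range k).card :=
        Finset.card_le_card_of_injOn Fin.val (fun p hp => by simpa using (hmem p).1 hp)
          Fin.val_injective.injOn
      simpa using h
    obtain ⟨Q, h1, h2, h3⟩ := exists_digit_test I (lehmerBits (ρ * π))
    refine ⟨Q, by simpa only [hmem] using h1, fun σ b => ?_,
      (Nat.cast_le.2 h2).trans (digit_test_depth_bound hn hk (by omega))⟩
    rw [h3]
    congr 3
    rw [Bool.eq_iff_iff]
    simp only [decide_eq_true_eq, hmem, partialAssignment_iff hkn hπ hρ σ]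
  -- Contradictory prescriptions (repeated values `j`) are satisfied by no permutation, so the empty
  -- circuit computes the predicate.
  · refine ⟨[], by simp [Circuit.ActsOn], fun σ b => ?_, by
      simp only [Circuit.depth, List.length_nil, Nat.cast_zero]; positivity⟩
    have : ¬ PartialAssignment i j σ := fun h => hex ⟨σ, h⟩
    simp [Circuit.mat, this]

theorem exists_partialRanking_circuit {n k : ℕ} (hn : 2 ≤ n) (hk : 1 ≤ k)
    {i : Fin (k + 1) ↪ Fin n} {π : Equiv.Perm (Fin n)}
    (hπ : ∀ (l : Fin (k + 1)) (p : Fin n), (p : ℕ) = n - 1 - k + (l : ℕ) → π p = i l) :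
    ∃ Q : Circuit (Option (LehmerWire n)),
      Q.ActsOn {o | ∀ v, o = some v → n - 1 - k ≤ (v.1 : ℕ)} ∧
      ComputesAfterReorder Q π (PartialRanking i) ∧
      (Q.depth : ℝ) ≤ 5000000 * (k : ℝ) ^ 2 * Real.log n ^ 2 := by
  have hkn : k + 1 ≤ n := by simpa using Fintype.card_le_of_embedding i
  set I : Finset (Fin n) := Finset.univ.filter fun p => n - 1 - k ≤ (p : ℕ) with hI
  have hmem : ∀ p, p ∈ I ↔ n - 1 - k ≤ (p : ℕ) := fun p => by simp [hI]
  have hcard : I.card ≤ k + 1 := by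
    have h : I.card ≤ (Finset.Ico (n - 1 - k) n).card :=
      Finset.card_le_card_of_injOn Fin.val
        (fun p hp => by simpa using (hmem p).1 hp) Fin.val_injective.injOn
    rw [Nat.card_Ico] at h
    omega
  obtain ⟨Q, h1, h2, h3⟩ := exists_digit_test I fun w => (n - 1 - (w.1 : ℕ)).testBit (w.2 : ℕ)
  refine ⟨Q, by simpa only [hmem] using h1, fun σ b => ?_,
    (Nat.cast_le.2 h2).trans (digit_test_depth_bound hn hk (by omega))⟩
  rw [h3]
  congr 3
  rw [Bool.eq_iff_iff]
  simp only [decide_eq_true_eq, hmem, partialRanking_iff hkn hπ σ]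

end

theorem mainTheorem6 :
    ∃ C : ℝ, 0 < C ∧ ∀ n : ℕ, 2 ≤ n →
      -- local, ancilla-free circuits for the adjacent-transposition updates
      ∃ V : Fin (n - 1) → Circuit (LehmerWire n),
        (∀ s : Fin (n - 1),
          Circuit.ActsOn (V s)
            {w | (w.1 : ℕ) = (s : ℕ) ∨ (w.1 : ℕ) = (s : ℕ) + 1} ∧
          ImplementsReorder (V s) (adjSwap s) ∧
          (Circuit.depth (V s) : ℝ) ≤ C * (n : ℝ) * Real.log n) ∧
        -- partial assignments of order `k`: the indices are brought to the beginning
        (∀ (k : ℕ), 1 ≤ k → ∀ i : Fin k ↪ Fin n,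
          ∃ (ts : List (Fin n)) (w : List (Fin (n - 1))) (π : Equiv.Perm (Fin n)),
            ts.length = k ∧ w = ts.flatMap frontWord ∧ π = wordPerm w ∧
            (∀ (l : Fin k) (p : Fin n), (p : ℕ) = k - 1 - (l : ℕ) → π p = i l) ∧
            w.length ≤ k * n ∧
            ImplementsReorder (wordCircuit V w) π ∧
            (Circuit.depth (wordCircuit V w) : ℝ) ≤ C * (k : ℝ) * (n : ℝ) ^ 2 * Real.log n ∧
            ∀ j : Fin k → Fin n, ∃ Q : Circuit (Option (LehmerWire n)),
              Circuit.ActsOn Q {o | ∀ v, o = some v → (v.1 : ℕ) < k} ∧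
              ComputesAfterReorder Q π (PartialAssignment i j) ∧
              (Circuit.depth Q : ℝ) ≤ C * (k : ℝ) ^ 2 * (Real.log n) ^ 2) ∧
        -- partial rankings of order `k` (`k + 1` indices): the indices are brought to the end
        (∀ (k : ℕ) (i : Fin (k + 1) ↪ Fin n),
          ∃ (ts : List (Fin n)) (w : List (Fin (n - 1))) (π : Equiv.Perm (Fin n)),
            ts.length = k + 1 ∧ w = ts.flatMap backWord ∧ π = wordPerm w ∧
            (∀ (l : Fin (k + 1)) (p : Fin n),
              (p : ℕ) = n - 1 - k + (l : ℕ) → π p = i l) ∧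
            w.length ≤ (k + 1) * n ∧
            ImplementsReorder (wordCircuit V w) π ∧
            (1 ≤ k →
              (Circuit.depth (wordCircuit V w) : ℝ) ≤ C * (k : ℝ) * (n : ℝ) ^ 2 * Real.log n ∧
              ∃ Q : Circuit (Option (LehmerWire n)),
                Circuit.ActsOn Q {o | ∀ v, o = some v → n - 1 - k ≤ (v.1 : ℕ)} ∧
                ComputesAfterReorder Q π (PartialRanking i) ∧
                (Circuit.depth Q : ℝ) ≤ C * (k : ℝ) ^ 2 * (Real.log n) ^ 2)) := by
  -- Twice the constant of the depth estimates: a ranking of order `k` moves `k + 1 ≤ 2 * k`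
  -- indices.
  refine ⟨10000000, by norm_num, fun n hn => ?_⟩
  choose V hV using fun s : Fin (n - 1) => exists_adjSwap_circuit (n := n) s
  have hn0 : (0 : ℝ) ≤ n := Nat.cast_nonneg n
  have hlog : 0 ≤ Real.log n := Real.log_nonneg (by exact_mod_cast (by omega : 1 ≤ n))
  have hD : ∀ s, (Circuit.depth (V s) : ℝ) ≤ 5000000 * n * Real.log n := fun s =>
    (Nat.cast_le.2 (hV s).2.2).trans (adjSwap_depth_bound hn)
  have hI := wordCircuit_implementsReorder fun s => (hV s).2.1
  have hdepth : ∀ (w : List (Fin (n - 1))) (k m : ℕ), w.length ≤ m * n → m ≤ 2 * k →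
      (Circuit.depth (wordCircuit V w) : ℝ) ≤ 10000000 * (k : ℝ) * (n : ℝ) ^ 2 * Real.log n := by
    intro w k m hw hm
    have h1 : (w.length : ℝ) ≤ 2 * k * n := by
      exact_mod_cast hw.trans (Nat.mul_le_mul_right n hm)
    calc (Circuit.depth (wordCircuit V w) : ℝ) ≤ w.length * (5000000 * n * Real.log n) :=
          depth_wordCircuit_le hD w
      _ ≤ 2 * k * n * (5000000 * n * Real.log n) := by gcongr
      _ = _ := by ring
  have hQ : ∀ k : ℕ, 5000000 * (k : ℝ) ^ 2 * Real.log n ^ 2 ≤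
      10000000 * (k : ℝ) ^ 2 * Real.log n ^ 2 := fun k => by gcongr; norm_num
  refine ⟨V, fun s => ⟨(hV s).1, (hV s).2.1, (hD s).trans ?_⟩, fun k hk i => ?_, fun k i => ?_⟩
  · gcongr
    norm_num
  · obtain ⟨ts, hlen, hts⟩ := exists_front k i
    have hw : (ts.flatMap frontWord).length ≤ k * n :=
      hlen ▸ length_flatMap_le _ length_frontWord_le ts
    refine ⟨ts, _, _, hlen, rfl, rfl, hts, hw, hI _, hdepth _ k k hw (by omega), fun j => ?_⟩
    obtain ⟨Q, h1, h2, h3⟩ := exists_partialAssignment_circuit hn hk j hts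
    exact ⟨Q, h1, h2, h3.trans (hQ k)⟩
  · have hkn : k + 1 ≤ n := by simpa using Fintype.card_le_of_embedding i
    obtain ⟨ts, hlen, hts'⟩ := exists_back (k + 1) i
    have hts : ∀ (l : Fin (k + 1)) (p : Fin n), (p : ℕ) = n - 1 - k + (l : ℕ) →
        wordPerm (ts.flatMap backWord) p = i l := fun l p hp => hts' l p (by omega)
    have hw : (ts.flatMap backWord).length ≤ (k + 1) * n :=
      hlen ▸ length_flatMap_le _ length_backWord_le ts
    refine ⟨ts, _, _, hlen, rfl, rfl, hts, hw, hI _, fun hk =>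
      ⟨hdepth _ k (k + 1) hw (by omega), ?_⟩⟩
    obtain ⟨Q, h1, h2, h3⟩ := exists_partialRanking_circuit hn hk hts
    exact ⟨Q, h1, h2, h3.trans (hQ k)⟩
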